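/- Let $k$ be an algebraically closed field of characteristic zero, and let $C$ be a $k$-coalgebra that is artinian, i.e. both its left coideals (subspaces $V$ with $\Delta(V)\subseteq C\otimes V$) and its right coideals (subspaces $V$ with $\Delta(V)\subseteq V\otimes C$) satisfy the descending chain condition. Let $C^*=\operatorname{Hom}_k(C,k)$ be the dual algebra, with the convolution product $(f*g)(c)=\sum f(c_{(1)})g(c_{(2)})$. For an integer $n$, a $k$-linear triangulated category $\mathcal T$ is called Calabi-Yau of dimension $n$ if $\operatorname{Hom}_{\mathcal T}(X,Y)$ is finite-dimensional over $k$ for all objects $X,Y$, and there are $k$-linear isomorphisms $\operatorname{Hom}_{\mathcal T}(X,Y)\cong\operatorname{Hom}_{\mathcal T}(Y,X[n])^*$, natural in $X$ and $Y$. A $k$-algebra $A$ is called (left) CY-$n$ if the bounded derived category $D^b_{fd}({}_A\mathcal M)$ of left $A$-modules with finite-dimensional cohomology is Calabi-Yau of dimension $n$; a $k$-coalgebra $C$ is called (left) CY-$n$ if the bounded derived category $D^b_{fd}({}^C\mathcal M)$ of left $C$-comodules with finite-dimensional cohomology is Calabi-Yau of dimension $n$. Then, for every integer $n$, the coalgebra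 $C$ is (left) CY-$n$ if and only if the algebra $C^*$ is (left) CY-$n$. -/

import Mathlib

open CategoryTheory CategoryTheory.Limits
open scoped TensorProduct

universe u v w

/-! ### Left comodules over a coalgebra -/

/-- A left comodule over a `k`-coalgebra `C`: a `k`-vector space `M` with a coassociative and
counital `k`-linear coaction `M → C ⊗ M`. -/
structure LeftComod (k : Type u) [Field k] (C : Type u) [AddCommGroup C] [Module k C]
    [Coalgebra k C] where
  carrier : Type u
  [addCommGroup : AddCommGroup carrier]
  [module : Module k carrier]
  coact : carrier →ₗ[k] C ⊗[k] carrier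
  coassoc : (TensorProduct.assoc k C C carrier).toLinearMap ∘ₗ
      (Coalgebra.comul (R := k) (A := C)).rTensor carrier ∘ₗ coact =
    coact.lTensor C ∘ₗ coact
  counit_coact : (TensorProduct.lid k carrier).toLinearMap ∘ₗ
      (Coalgebra.counit (R := k) (A := C)).rTensor carrier ∘ₗ coact = LinearMap.id

namespace LeftComod

attribute [instance] LeftComod.addCommGroup LeftComod.module

variable {k : Type u} [Field k] {C : Type u} [AddCommGroup C] [Module k C] [Coalgebra k C]

/-- Morphisms of left comodules: the `k`-linear maps that commute with the coactions. -/
@[ext]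
structure Hom (M N : LeftComod k C) where
  toLin : M.carrier →ₗ[k] N.carrier
  comm : N.coact ∘ₗ toLin = toLin.lTensor C ∘ₗ M.coact

instance instCategory : Category (LeftComod k C) where
  Hom M N := Hom M N
  id M := ⟨LinearMap.id, by simp⟩
  comp f g := ⟨g.toLin ∘ₗ f.toLin, by
    rw [← LinearMap.comp_assoc, g.comm, LinearMap.comp_assoc, f.comm, LinearMap.lTensor_comp,
      LinearMap.comp_assoc]⟩

/-- The underlying linear map of a morphism of comodules. -/
abbrev lin {M N : LeftComod k C} (f : M ⟶ N) : M.carrier →ₗ[k] N.carrier := Hom.toLin f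

lemma lin_comm {M N : LeftComod k C} (f : M ⟶ N) :
    N.coact ∘ₗ lin f = (lin f).lTensor C ∘ₗ M.coact := Hom.comm f

lemma lin_comm_apply {M N : LeftComod k C} (f : M ⟶ N) (x : M.carrier) :
    N.coact (lin f x) = (lin f).lTensor C (M.coact x) := LinearMap.congr_fun (lin_comm f) x

/-- Build a morphism of comodules. -/
abbrev mkHom {M N : LeftComod k C} (f : M.carrier →ₗ[k] N.carrier)
    (h : N.coact ∘ₗ f = f.lTensor C ∘ₗ M.coact) : M ⟶ N := Hom.mk f h

@[ext]
lemma hom_ext {M N : LeftComod k C} {f g : M ⟶ N} (h : lin f = lin g) : f = g := Hom.ext h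

lemma lin_injective {M N : LeftComod k C} :
    Function.Injective (lin : (M ⟶ N) → (M.carrier →ₗ[k] N.carrier)) := fun _ _ h => hom_ext h

@[simp] lemma lin_mkHom {M N : LeftComod k C} (f : M.carrier →ₗ[k] N.carrier)
    (h : N.coact ∘ₗ f = f.lTensor C ∘ₗ M.coact) : lin (mkHom f h) = f := rfl
@[simp] lemma lin_id (M : LeftComod k C) : lin (𝟙 M) = LinearMap.id := rfl
@[simp] lemma lin_comp {M N L : LeftComod k C} (f : M ⟶ N) (g : N ⟶ L) :
    lin (f ≫ g) = lin g ∘ₗ lin f := rfl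

section linear

variable (M N : LeftComod k C)

instance instHomZero : Zero (M ⟶ N) := ⟨mkHom 0 (by simp)⟩
instance instHomAdd : Add (M ⟶ N) := ⟨fun f g => mkHom (lin f + lin g) (by
  rw [LinearMap.comp_add, lin_comm, lin_comm, LinearMap.lTensor_add, LinearMap.add_comp])⟩
instance instHomNeg : Neg (M ⟶ N) := ⟨fun f => mkHom (-lin f) (by
  rw [LinearMap.comp_neg, lin_comm, LinearMap.lTensor_neg, LinearMap.neg_comp])⟩
instance instHomSub : Sub (M ⟶ N) := ⟨fun f g => mkHom (lin f - lin g) (by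
  rw [LinearMap.comp_sub, lin_comm, lin_comm, LinearMap.lTensor_sub, LinearMap.sub_comp])⟩
instance instHomSMul : SMul k (M ⟶ N) := ⟨fun a f => mkHom (a • lin f) (by
  rw [LinearMap.comp_smul, lin_comm, LinearMap.lTensor_smul, LinearMap.smul_comp])⟩
instance instHomNSMul : SMul ℕ (M ⟶ N) := ⟨fun a f => mkHom (a • lin f) (by
  rw [← Nat.cast_smul_eq_nsmul k, LinearMap.comp_smul, lin_comm, LinearMap.lTensor_smul,
    LinearMap.smul_comp])⟩
instance instHomZSMul : SMul ℤ (M ⟶ N) := ⟨fun a f => mkHom (a • lin f) (by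
  rw [← Int.cast_smul_eq_zsmul k, LinearMap.comp_smul, lin_comm, LinearMap.lTensor_smul,
    LinearMap.smul_comp])⟩

instance instHomAddCommGroup : AddCommGroup (M ⟶ N) :=
  Function.Injective.addCommGroup lin lin_injective rfl (fun _ _ => rfl) (fun _ => rfl)
    (fun _ _ => rfl) (fun _ _ => rfl) (fun _ _ => rfl)

/-- `lin` as an additive map. -/
def linAddHom : (M ⟶ N) →+ (M.carrier →ₗ[k] N.carrier) where
  toFun := lin
  map_zero' := rfl
  map_add' _ _ := rfl

instance instHomModule : Module k (M ⟶ N) :=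
  Function.Injective.module k (linAddHom M N) lin_injective (fun _ _ => rfl)

end linear

@[simp] lemma lin_zero (M N : LeftComod k C) : lin (0 : M ⟶ N) = 0 := rfl
@[simp] lemma lin_add {M N : LeftComod k C} (f g : M ⟶ N) : lin (f + g) = lin f + lin g := rfl
@[simp] lemma lin_smul {M N : LeftComod k C} (a : k) (f : M ⟶ N) :
    lin (a • f) = a • lin f := rfl

instance instPreadditive : Preadditive (LeftComod k C) where
  add_comp _ _ _ f g h := by ext1; simp [LinearMap.comp_add]
  comp_add _ _ _ f g h := by ext1; simp [LinearMap.add_comp]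

instance instLinear : Linear k (LeftComod k C) where
  smul_comp _ _ _ a f g := by ext1; simp [LinearMap.comp_smul]
  comp_smul _ _ _ f a g := by ext1; simp [LinearMap.smul_comp]

/-! #### The category of left comodules is abelian -/

section transport

variable {V W : Type u} [AddCommGroup V] [Module k V] [AddCommGroup W] [Module k W]

lemma comul_natural (i : V →ₗ[k] W) (y : C ⊗[k] V) :
    (i.lTensor C).lTensor C ((TensorProduct.assoc k C C V)
      ((Coalgebra.comul (R := k) (A := C)).rTensor V y)) =
    (TensorProduct.assoc k C C W)
      ((Coalgebra.comul (R := k) (A := C)).rTensor W (i.lTensor C y)) := by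
  induction y with
  | zero => simp
  | add a b ha hb => simp only [map_add, ha, hb]
  | tmul c v =>
    simp only [LinearMap.rTensor_tmul, LinearMap.lTensor_tmul]
    induction (Coalgebra.comul (R := k) c) with
    | zero => simp
    | add a b ha hb => simp only [TensorProduct.add_tmul, map_add, ha, hb]
    | tmul a b => simp

lemma counit_natural (i : V →ₗ[k] W) (y : C ⊗[k] V) :
    i ((TensorProduct.lid k V) ((Coalgebra.counit (R := k) (A := C)).rTensor V y)) =
    (TensorProduct.lid k W)
      ((Coalgebra.counit (R := k) (A := C)).rTensor W (i.lTensor C y)) := by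
  induction y with
  | zero => simp
  | add a b ha hb => simp only [map_add, ha, hb]
  | tmul c v => simp

lemma coact_natural (i : V →ₗ[k] W) (ρ : V →ₗ[k] C ⊗[k] V) (σ : W →ₗ[k] C ⊗[k] W)
    (h : σ ∘ₗ i = i.lTensor C ∘ₗ ρ) (y : C ⊗[k] V) :
    σ.lTensor C (i.lTensor C y) = (i.lTensor C).lTensor C (ρ.lTensor C y) := by
  rw [← LinearMap.comp_apply, ← LinearMap.comp_apply, ← LinearMap.lTensor_comp,
    ← LinearMap.lTensor_comp, h]

lemma coassoc_comp (M : LeftComod k C) (i : M.carrier →ₗ[k] W) (σ : W →ₗ[k] C ⊗[k] W)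
    (h : σ ∘ₗ i = i.lTensor C ∘ₗ M.coact) :
    ((TensorProduct.assoc k C C W).toLinearMap ∘ₗ
      (Coalgebra.comul (R := k) (A := C)).rTensor W ∘ₗ σ) ∘ₗ i = (σ.lTensor C ∘ₗ σ) ∘ₗ i := by
  apply LinearMap.ext
  intro x
  have hx : σ (i x) = i.lTensor C (M.coact x) := LinearMap.congr_fun h x
  have e := LinearMap.congr_fun M.coassoc x
  simp only [LinearMap.comp_apply, LinearEquiv.coe_coe] at e ⊢
  rw [hx, coact_natural i _ _ h, ← comul_natural, e]

lemma counit_comp (M : LeftComod k C) (i : M.carrier →ₗ[k] W) (σ : W →ₗ[k] C ⊗[k] W)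
    (h : σ ∘ₗ i = i.lTensor C ∘ₗ M.coact) :
    ((TensorProduct.lid k W).toLinearMap ∘ₗ
      (Coalgebra.counit (R := k) (A := C)).rTensor W ∘ₗ σ) ∘ₗ i = LinearMap.id ∘ₗ i := by
  apply LinearMap.ext
  intro x
  have hx : σ (i x) = i.lTensor C (M.coact x) := LinearMap.congr_fun h x
  have e := LinearMap.congr_fun M.counit_coact x
  simp only [LinearMap.comp_apply, LinearEquiv.coe_coe, LinearMap.id_apply] at e ⊢
  rw [hx, ← counit_natural, e]

end transport

/-- The comodule structure on a subspace of a comodule that is stable under the coaction. -/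
def ofInjective (M : LeftComod k C) (V : Type u) [AddCommGroup V] [Module k V]
    (i : V →ₗ[k] M.carrier) (hi : Function.Injective i) (ρ : V →ₗ[k] C ⊗[k] V)
    (h : M.coact ∘ₗ i = i.lTensor C ∘ₗ ρ) : LeftComod k C where
  carrier := V
  coact := ρ
  coassoc := by
    have hi2 : Function.Injective ((i.lTensor C).lTensor C) :=
      Module.Flat.lTensor_preserves_injective_linearMap _
        (Module.Flat.lTensor_preserves_injective_linearMap _ hi)
    apply LinearMap.ext
    intro x
    apply hi2
    have hx : M.coact (i x) = i.lTensor C (ρ x) := LinearMap.congr_fun h x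
    have e := LinearMap.congr_fun M.coassoc (i x)
    simp only [LinearMap.comp_apply, LinearEquiv.coe_coe] at e ⊢
    rw [comul_natural, ← coact_natural i _ _ h, ← hx, e]
  counit_coact := by
    apply LinearMap.ext
    intro x
    apply hi
    have hx : M.coact (i x) = i.lTensor C (ρ x) := LinearMap.congr_fun h x
    have e := LinearMap.congr_fun M.counit_coact (i x)
    simp only [LinearMap.comp_apply, LinearEquiv.coe_coe, LinearMap.id_apply] at e ⊢
    rw [counit_natural, ← hx, e]

/-- The comodule structure on a quotient space of a comodule to which the coaction descends. -/
def ofSurjective (M : LeftComod k C) (V : Type u) [AddCommGroup V] [Module k V]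
    (p : M.carrier →ₗ[k] V) (hp : Function.Surjective p) (ρ : V →ₗ[k] C ⊗[k] V)
    (h : ρ ∘ₗ p = p.lTensor C ∘ₗ M.coact) : LeftComod k C where
  carrier := V
  coact := ρ
  coassoc := (LinearMap.cancel_right hp).1 (coassoc_comp M p ρ h)
  counit_coact := (LinearMap.cancel_right hp).1 (counit_comp M p ρ h)

section kernels

variable {M N : LeftComod k C} (f : M ⟶ N)

lemma coact_mem_range_of_mem_ker (x : LinearMap.ker (lin f)) :
    M.coact x ∈ LinearMap.range ((LinearMap.ker (lin f)).subtype.lTensor C) := by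
  have hex : Function.Exact ((LinearMap.ker (lin f)).subtype.lTensor C) ((lin f).lTensor C) :=
    Module.Flat.lTensor_exact C (LinearMap.exact_subtype_ker_map (lin f))
  exact (hex _).1 (by rw [← lin_comm_apply, x.2, map_zero])

lemma lTensor_subtype_injective (V : Submodule k M.carrier) :
    Function.Injective (V.subtype.lTensor C) :=
  Module.Flat.lTensor_preserves_injective_linearMap _ V.injective_subtype

/-- The coaction on the kernel of a morphism. -/
noncomputable def kerCoact :
    LinearMap.ker (lin f) →ₗ[k] C ⊗[k] LinearMap.ker (lin f) :=
  (LinearEquiv.ofInjective _ (lTensor_subtype_injective (LinearMap.ker (lin f)))).symm.toLinearMap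
    ∘ₗ LinearMap.codRestrict (LinearMap.range ((LinearMap.ker (lin f)).subtype.lTensor C))
      (M.coact ∘ₗ (LinearMap.ker (lin f)).subtype) (coact_mem_range_of_mem_ker f)

lemma kerCoact_spec : M.coact ∘ₗ (LinearMap.ker (lin f)).subtype =
    (LinearMap.ker (lin f)).subtype.lTensor C ∘ₗ kerCoact f := by
  apply LinearMap.ext
  intro x
  have := congrArg Subtype.val (LinearEquiv.apply_symm_apply
    (LinearEquiv.ofInjective _ (lTensor_subtype_injective (LinearMap.ker (lin f))))
    (LinearMap.codRestrict (LinearMap.range ((LinearMap.ker (lin f)).subtype.lTensor C))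
      (M.coact ∘ₗ (LinearMap.ker (lin f)).subtype) (coact_mem_range_of_mem_ker f) x))
  exact this.symm

/-- The kernel of a morphism of comodules. -/
noncomputable def ker : LeftComod k C :=
  ofInjective M (LinearMap.ker (lin f)) _ (Submodule.injective_subtype _) (kerCoact f)
    (kerCoact_spec f)

/-- The inclusion of the kernel. -/
noncomputable def kerι : ker f ⟶ M :=
  mkHom (M := ker f) (LinearMap.ker (lin f)).subtype (kerCoact_spec f)

/-- The coaction on the cokernel of a morphism. -/
noncomputable def cokerCoact :
    (N.carrier ⧸ LinearMap.range (lin f)) →ₗ[k] C ⊗[k] (N.carrier ⧸ LinearMap.range (lin f)) :=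
  Submodule.liftQ _ ((LinearMap.range (lin f)).mkQ.lTensor C ∘ₗ N.coact) (by
    rintro _ ⟨x, rfl⟩
    rw [LinearMap.mem_ker, LinearMap.comp_apply, lin_comm_apply, ← LinearMap.comp_apply,
      ← LinearMap.lTensor_comp, LinearMap.range_mkQ_comp, LinearMap.lTensor_zero,
      LinearMap.zero_apply])

lemma cokerCoact_spec : cokerCoact f ∘ₗ (LinearMap.range (lin f)).mkQ =
    (LinearMap.range (lin f)).mkQ.lTensor C ∘ₗ N.coact :=
  Submodule.liftQ_mkQ _ _ _

/-- The cokernel of a morphism of comodules. -/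
noncomputable def coker : LeftComod k C :=
  ofSurjective N (N.carrier ⧸ LinearMap.range (lin f)) _ (Submodule.mkQ_surjective _)
    (cokerCoact f) (cokerCoact_spec f)

/-- The projection to the cokernel. -/
noncomputable def cokerπ : N ⟶ coker f :=
  mkHom (N := coker f) (LinearMap.range (lin f)).mkQ (cokerCoact_spec f)

/-- A morphism that lands in the image of an injective morphism lifts along it. -/
lemma exists_lift {L : LeftComod k C} (hf : Function.Injective (lin f)) (g : L ⟶ N)
    (hg : ∀ x, lin g x ∈ LinearMap.range (lin f)) : ∃ l : L ⟶ M, l ≫ f = g := by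
  let l : L.carrier →ₗ[k] M.carrier :=
    (LinearEquiv.ofInjective _ hf).symm.toLinearMap ∘ₗ
      LinearMap.codRestrict (LinearMap.range (lin f)) (lin g) hg
  have hl : lin f ∘ₗ l = lin g := by
    apply LinearMap.ext
    intro x
    exact congrArg Subtype.val (LinearEquiv.apply_symm_apply (LinearEquiv.ofInjective _ hf)
      (LinearMap.codRestrict (LinearMap.range (lin f)) (lin g) hg x))
  refine ⟨mkHom l ?_, by ext1; exact hl⟩
  have hfC : Function.Injective ((lin f).lTensor C) :=
    Module.Flat.lTensor_preserves_injective_linearMap _ hf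
  apply LinearMap.ext
  intro x
  apply hfC
  have h1 : lin f (l x) = lin g x := LinearMap.congr_fun hl x
  have h2 : ∀ y, (lin f).lTensor C (l.lTensor C y) = (lin g).lTensor C y := fun y => by
    rw [← hl]
    exact (LinearMap.congr_fun (LinearMap.lTensor_comp C (lin f) l) y).symm
  change (lin f).lTensor C (M.coact (l x)) = (lin f).lTensor C (l.lTensor C (L.coact x))
  rw [← lin_comm_apply, h1, h2, lin_comm_apply]

/-- A morphism that kills the kernel of a surjective morphism descends along it. -/
lemma exists_desc {L : LeftComod k C} (hf : Function.Surjective (lin f)) (g : M ⟶ L)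
    (hg : LinearMap.ker (lin f) ≤ LinearMap.ker (lin g)) : ∃ l : N ⟶ L, f ≫ l = g := by
  let l : N.carrier →ₗ[k] L.carrier :=
    Submodule.liftQ _ (lin g) hg ∘ₗ ((lin f).quotKerEquivOfSurjective hf).symm.toLinearMap
  have hl : l ∘ₗ lin f = lin g := by
    apply LinearMap.ext
    intro x
    have : ((lin f).quotKerEquivOfSurjective hf).symm (lin f x) = Submodule.Quotient.mk x := by
      rw [LinearEquiv.symm_apply_eq]; rfl
    simp only [l, LinearMap.comp_apply, LinearEquiv.coe_coe, this]
    rfl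
  refine ⟨mkHom l ?_, by ext1; exact hl⟩
  apply LinearMap.ext
  intro y
  obtain ⟨x, rfl⟩ := hf y
  have h1 : l (lin f x) = lin g x := LinearMap.congr_fun hl x
  have h2 : ∀ y, l.lTensor C ((lin f).lTensor C y) = (lin g).lTensor C y := fun y => by
    rw [← hl]
    exact (LinearMap.congr_fun (LinearMap.lTensor_comp C l (lin f)) y).symm
  change L.coact (l (lin f x)) = l.lTensor C (N.coact (lin f x))
  rw [h1, lin_comm_apply, lin_comm_apply, h2]

lemma kerι_comp : kerι f ≫ f = 0 := by
  ext1
  apply LinearMap.ext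
  intro x
  exact x.2

lemma comp_cokerπ : f ≫ cokerπ f = 0 := by
  ext1
  exact LinearMap.range_mkQ_comp _

lemma mono_of_injective (hf : Function.Injective (lin f)) : Mono f where
  right_cancellation g h e := by
    ext1
    apply LinearMap.ext
    intro x
    exact hf (LinearMap.congr_fun (congrArg lin e) x)

lemma epi_of_surjective (hf : Function.Surjective (lin f)) : Epi f where
  left_cancellation g h e := by
    ext1
    apply LinearMap.ext
    intro y
    obtain ⟨x, rfl⟩ := hf y
    exact LinearMap.congr_fun (congrArg lin e) x

lemma injective_of_mono [Mono f] : Function.Injective (lin f) := by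
  have h : kerι f = 0 := by
    rw [← cancel_mono f, kerι_comp, zero_comp]
  rw [← LinearMap.ker_eq_bot, eq_bot_iff]
  intro x hx
  exact LinearMap.congr_fun (congrArg lin h) ⟨x, hx⟩

lemma surjective_of_epi [Epi f] : Function.Surjective (lin f) := by
  have h : cokerπ f = 0 := by
    rw [← cancel_epi f, comp_cokerπ, comp_zero]
  rw [← LinearMap.range_eq_top, eq_top_iff]
  intro x _
  have := LinearMap.congr_fun (congrArg lin h) x
  exact (Submodule.Quotient.mk_eq_zero _).1 this

lemma kerι_injective : Function.Injective (lin (kerι f)) := Submodule.injective_subtype _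

lemma cokerπ_surjective : Function.Surjective (lin (cokerπ f)) := Submodule.mkQ_surjective _

lemma exists_lift_ker {L : LeftComod k C} (g : L ⟶ M) (hg : g ≫ f = 0) :
    ∃ l : L ⟶ ker f, l ≫ kerι f = g :=
  exists_lift (kerι f) (kerι_injective f) g fun x =>
    ⟨⟨lin g x, LinearMap.congr_fun (congrArg lin hg) x⟩, rfl⟩

lemma exists_desc_coker {L : LeftComod k C} (g : N ⟶ L) (hg : f ≫ g = 0) :
    ∃ l : coker f ⟶ L, cokerπ f ≫ l = g :=
  exists_desc (cokerπ f) (cokerπ_surjective f) g (by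
    intro y hy
    obtain ⟨x, rfl⟩ : y ∈ LinearMap.range (lin f) := (Submodule.Quotient.mk_eq_zero _).1 hy
    exact LinearMap.congr_fun (congrArg lin hg) x)

/-- `ker f` is a kernel in the category of comodules. -/
noncomputable def kerIsLimit : IsLimit (KernelFork.ofι (kerι f) (kerι_comp f)) :=
  have := mono_of_injective _ (kerι_injective f)
  KernelFork.IsLimit.ofι' _ _ fun g hg =>
    ⟨(exists_lift_ker f g hg).choose, (exists_lift_ker f g hg).choose_spec⟩

/-- `coker f` is a cokernel in the category of comodules. -/
noncomputable def cokerIsColimit : IsColimit (CokernelCofork.ofπ (cokerπ f) (comp_cokerπ f)) :=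
  have := epi_of_surjective _ (cokerπ_surjective f)
  CokernelCofork.IsColimit.ofπ' _ _ fun g hg =>
    ⟨(exists_desc_coker f g hg).choose, (exists_desc_coker f g hg).choose_spec⟩

end kernels

instance instHasKernels : HasKernels (LeftComod k C) where
  has_limit f := ⟨⟨⟨_, kerIsLimit f⟩⟩⟩

instance instHasCokernels : HasCokernels (LeftComod k C) where
  has_colimit f := ⟨⟨⟨_, cokerIsColimit f⟩⟩⟩

instance instNormalMono : IsNormalMonoCategory (LeftComod k C) where
  normalMonoOfMono f _ := ⟨⟨_, cokerπ f, comp_cokerπ f,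
    KernelFork.IsLimit.ofι' _ _ fun g hg =>
      have h := exists_lift f (injective_of_mono f) g fun x =>
        (Submodule.Quotient.mk_eq_zero _).1 (LinearMap.congr_fun (congrArg lin hg) x)
      ⟨h.choose, h.choose_spec⟩⟩⟩

instance instNormalEpi : IsNormalEpiCategory (LeftComod k C) where
  normalEpiOfEpi f _ := ⟨⟨_, kerι f, kerι_comp f,
    CokernelCofork.IsColimit.ofπ' _ _ fun g hg =>
      have h := exists_desc f (surjective_of_epi f) g fun x hx =>
        LinearMap.congr_fun (congrArg lin hg) ⟨x, hx⟩
      ⟨h.choose, h.choose_spec⟩⟩⟩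

/-- The zero comodule. -/
def zeroComod (k : Type u) [Field k] (C : Type u) [AddCommGroup C] [Module k C]
    [Coalgebra k C] : LeftComod k C where
  carrier := PUnit
  coact := 0
  coassoc := by simp
  counit_coact := Subsingleton.elim _ _

instance instHasZeroObject : HasZeroObject (LeftComod k C) :=
  ⟨⟨zeroComod k C, (IsZero.iff_id_eq_zero _).2 (by
    ext1; apply LinearMap.ext; intro x; exact Subsingleton.elim (α := PUnit) _ _)⟩⟩

/-- The coaction on the direct sum of two comodules. -/
def prodCoact (M N : LeftComod k C) :
    M.carrier × N.carrier →ₗ[k] C ⊗[k] (M.carrier × N.carrier) :=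
  ((LinearMap.inl k M.carrier N.carrier).lTensor C ∘ₗ M.coact).coprod
    ((LinearMap.inr k M.carrier N.carrier).lTensor C ∘ₗ N.coact)

/-- The direct sum of two comodules. -/
def prod (M N : LeftComod k C) : LeftComod k C where
  carrier := M.carrier × N.carrier
  coact := prodCoact M N
  coassoc := LinearMap.prod_ext
    (coassoc_comp M _ _ (LinearMap.coprod_inl _ _)) (coassoc_comp N _ _ (LinearMap.coprod_inr _ _))
  counit_coact := LinearMap.prod_ext
    (counit_comp M _ _ (LinearMap.coprod_inl _ _)) (counit_comp N _ _ (LinearMap.coprod_inr _ _))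

lemma fst_prodCoact (M N : LeftComod k C) : M.coact ∘ₗ LinearMap.fst k _ _ =
    (LinearMap.fst k M.carrier N.carrier).lTensor C ∘ₗ prodCoact M N := by
  apply LinearMap.prod_ext
  · rw [LinearMap.comp_assoc, LinearMap.comp_assoc, prodCoact, LinearMap.coprod_inl,
      ← LinearMap.comp_assoc _ _ (LinearMap.lTensor C _), ← LinearMap.lTensor_comp,
      LinearMap.fst_comp_inl, LinearMap.lTensor_id, LinearMap.id_comp, LinearMap.comp_id]
  · rw [LinearMap.comp_assoc, LinearMap.comp_assoc, prodCoact, LinearMap.coprod_inr,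
      ← LinearMap.comp_assoc _ _ (LinearMap.lTensor C _), ← LinearMap.lTensor_comp,
      LinearMap.fst_comp_inr, LinearMap.lTensor_zero, LinearMap.zero_comp, LinearMap.comp_zero]

lemma snd_prodCoact (M N : LeftComod k C) : N.coact ∘ₗ LinearMap.snd k _ _ =
    (LinearMap.snd k M.carrier N.carrier).lTensor C ∘ₗ prodCoact M N := by
  apply LinearMap.prod_ext
  · rw [LinearMap.comp_assoc, LinearMap.comp_assoc, prodCoact, LinearMap.coprod_inl,
      ← LinearMap.comp_assoc _ _ (LinearMap.lTensor C _), ← LinearMap.lTensor_comp,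
      LinearMap.snd_comp_inl, LinearMap.lTensor_zero, LinearMap.zero_comp, LinearMap.comp_zero]
  · rw [LinearMap.comp_assoc, LinearMap.comp_assoc, prodCoact, LinearMap.coprod_inr,
      ← LinearMap.comp_assoc _ _ (LinearMap.lTensor C _), ← LinearMap.lTensor_comp,
      LinearMap.snd_comp_inr, LinearMap.lTensor_id, LinearMap.id_comp, LinearMap.comp_id]

/-- The biproduct data on the direct sum of two comodules. -/
def prodBicone (M N : LeftComod k C) : BinaryBicone M N where
  pt := prod M N
  fst := mkHom (M := prod M N) (LinearMap.fst k _ _) (fst_prodCoact M N)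
  snd := mkHom (M := prod M N) (LinearMap.snd k _ _) (snd_prodCoact M N)
  inl := mkHom (N := prod M N) (LinearMap.inl k _ _) (LinearMap.coprod_inl _ _)
  inr := mkHom (N := prod M N) (LinearMap.inr k _ _) (LinearMap.coprod_inr _ _)
  inl_fst := by ext1; exact LinearMap.fst_comp_inl ..
  inl_snd := by ext1; exact LinearMap.snd_comp_inl ..
  inr_fst := by ext1; exact LinearMap.fst_comp_inr ..
  inr_snd := by ext1; exact LinearMap.snd_comp_inr ..

lemma prodBicone_total (M N : LeftComod k C) :
    (prodBicone M N).fst ≫ (prodBicone M N).inl + (prodBicone M N).snd ≫ (prodBicone M N).inr =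
      𝟙 (prodBicone M N).pt := by
  ext1
  apply LinearMap.ext
  rintro ⟨x, y⟩
  exact Prod.ext (add_zero x) (zero_add y)

instance instHasBinaryBiproducts : HasBinaryBiproducts (LeftComod k C) where
  has_binary_biproduct M N := hasBinaryBiproduct_of_total (prodBicone M N) (prodBicone_total M N)

noncomputable instance instAbelian : Abelian (LeftComod k C) :=
  have : HasFiniteProducts (LeftComod k C) := hasFiniteProducts_of_has_binary_and_terminal
  { }

end LeftComod

/-! ### Artinian coalgebras and the dual algebra -/

/-- `C` is artinian on both sides: the left coideals (the subspaces `V` with `Δ V ⊆ C ⊗ V`, that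
is, the subcomodules of the left comodule `C`) satisfy the descending chain condition, and so do
the right coideals (the subspaces `V` with `Δ V ⊆ V ⊗ C`). -/
structure Coalgebra.IsArtinian (k : Type u) [Field k] (C : Type v) [AddCommGroup C] [Module k C]
    [Coalgebra k C] : Prop where
  left : WellFoundedLT {V : Submodule k C //
    ∀ c ∈ V, Coalgebra.comul (R := k) c ∈ LinearMap.range (V.subtype.lTensor C)}
  right : WellFoundedLT {V : Submodule k C //
    ∀ c ∈ V, Coalgebra.comul (R := k) c ∈ LinearMap.range (V.subtype.rTensor C)}

/-- The dual algebra `C*` of a coalgebra: the linear forms on `C` with the convolution product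
`(f * g) c = ∑ f c₁ * g c₂` and the counit as unit. -/
abbrev Coalgebra.DualAlgebra (k : Type u) [Field k] (C : Type v) [AddCommGroup C] [Module k C]
    [Coalgebra k C] : Type (max u v) := WithConv (C →ₗ[k] k)

/-! ### Calabi-Yau categories -/

/-- A `k`-linear triangulated category is Calabi-Yau of dimension `n` if it is Hom-finite and there
are `k`-linear isomorphisms `Hom(X, Y) ≅ Hom(Y, X[n])*`, natural in `X` and in `Y`. -/
structure IsCalabiYauCategory (k : Type u) [Field k] (T : Type v) [Category.{w} T]
    [Preadditive T] [Linear k T] [HasZeroObject T] [HasShift T ℤ]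
    [∀ m : ℤ, (shiftFunctor T m).Additive] [Pretriangulated T] [IsTriangulated T]
    (n : ℤ) : Prop where
  hom_finite : ∀ X Y : T, Module.Finite k (X ⟶ Y)
  exists_duality : ∃ η : ∀ X Y : T, (X ⟶ Y) ≃ₗ[k] Module.Dual k (Y ⟶ X⟦n⟧),
    (∀ (X Y Y' : T) (f : X ⟶ Y) (g : Y ⟶ Y') (h : Y' ⟶ X⟦n⟧),
      η X Y' (f ≫ g) h = η X Y f (g ≫ h)) ∧
    (∀ (X' X Y : T) (a : X' ⟶ X) (f : X ⟶ Y) (h : Y ⟶ X'⟦n⟧),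
      η X' Y (a ≫ f) h = η X Y f (h ≫ a⟦n⟧'))

/-! ### Derived categories of bounded complexes with finite-dimensional cohomology -/

section derived

variable {A : Type v} [Category.{w} A] [Abelian A] [HasDerivedCategory.{u} A]

/-- The objects of the derived category all of whose cohomology objects satisfy `P`. -/
def DerivedCategory.cohomologyIn (P : ObjectProperty A) : ObjectProperty (DerivedCategory A) :=
  fun X => ∀ i : ℤ, P ((DerivedCategory.homologyFunctor A i).obj X)

/-- The objects of the derived category with bounded cohomology all of whose cohomology objects
satisfy `P`. -/
def DerivedCategory.boundedCohomologyIn (P : ObjectProperty A) :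
    ObjectProperty (DerivedCategory A) :=
  (DerivedCategory.TStructure.t (C := A)).bounded ⊓ DerivedCategory.cohomologyIn P

instance DerivedCategory.cohomologyIn_isTriangulated (P : ObjectProperty A) [P.IsSerreClass] :
    (DerivedCategory.cohomologyIn P).IsTriangulated where
  exists_zero := ⟨_, isZero_zero _, fun i =>
    P.prop_of_isZero ((DerivedCategory.homologyFunctor A i).map_isZero (isZero_zero _))⟩
  isStableUnderShiftBy n := ⟨fun X hX i => P.prop_of_iso
    (((DerivedCategory.homologyFunctor A 0).shiftIso n i (n + i) rfl).symm.app X) (hX (n + i))⟩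
  toIsTriangulatedClosed₂ := ⟨fun T hT h₁ h₃ => ObjectProperty.le_isoClosure _ _ fun i =>
    P.prop_X₂_of_exact (DerivedCategory.HomologySequence.exact₂ T hT i) (h₁ i) (h₃ i)⟩

instance DerivedCategory.cohomologyIn_isClosedUnderIsomorphisms (P : ObjectProperty A)
    [P.IsClosedUnderIsomorphisms] :
    (DerivedCategory.cohomologyIn P).IsClosedUnderIsomorphisms where
  of_iso e hX i := P.prop_of_iso ((DerivedCategory.homologyFunctor A i).mapIso e) (hX i)

instance DerivedCategory.boundedCohomologyIn_isTriangulated (P : ObjectProperty A)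
    [P.IsSerreClass] : (DerivedCategory.boundedCohomologyIn P).IsTriangulated := by
  unfold DerivedCategory.boundedCohomologyIn
  infer_instance

end derived

/-- The left modules over a `k`-algebra that are finite-dimensional over `k`. -/
def ModuleCat.finiteDimensional (k : Type u) [Field k] (A : Type u) [Ring A] [Algebra k A] :
    ObjectProperty (ModuleCat.{u} A) :=
  fun M => Module.Finite k ((ModuleCat.restrictScalars (algebraMap k A)).obj M)

/-- The left comodules over a `k`-coalgebra that are finite-dimensional over `k`. -/
def LeftComod.finiteDimensional (k : Type u) [Field k] (C : Type u) [AddCommGroup C] [Module k C]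
    [Coalgebra k C] : ObjectProperty (LeftComod k C) :=
  fun M => Module.Finite k M.carrier

instance ModuleCat.finiteDimensional_isSerreClass (k : Type u) [Field k] (A : Type u) [Ring A]
    [Algebra k A] : (ModuleCat.finiteDimensional k A).IsSerreClass where
  exists_zero := ⟨ModuleCat.of A PUnit.{u + 1}, ModuleCat.isZero_of_subsingleton _,
    have : Subsingleton ((ModuleCat.restrictScalars (algebraMap k A)).obj
      (ModuleCat.of A PUnit.{u + 1})) := inferInstanceAs (Subsingleton PUnit.{u + 1})
    (Module.Finite.of_finite :
      Module.Finite k ((ModuleCat.restrictScalars (algebraMap k A)).obj _))⟩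
  prop_of_mono f _ h := by
    have : Module.Finite k _ := h
    exact Module.Finite.of_injective ((ModuleCat.restrictScalars (algebraMap k A)).map f).hom
      ((ModuleCat.mono_iff_injective f).1 inferInstance)
  prop_of_epi f _ h := by
    have : Module.Finite k _ := h
    exact Module.Finite.of_surjective ((ModuleCat.restrictScalars (algebraMap k A)).map f).hom
      ((ModuleCat.epi_iff_surjective f).1 inferInstance)
  prop_X₂_of_shortExact {S} hS h₁ h₃ := by
    have : Module.Finite k ((ModuleCat.restrictScalars (algebraMap k A)).obj S.X₁) := h₁
    have : Module.Finite k ((ModuleCat.restrictScalars (algebraMap k A)).obj S.X₃) := h₃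
    exact Module.Finite.of_exact (f := ((ModuleCat.restrictScalars (algebraMap k A)).map S.f).hom)
      (g := ((ModuleCat.restrictScalars (algebraMap k A)).map S.g).hom)
      ((ShortComplex.ShortExact.moduleCat_exact_iff_function_exact S).1 hS.exact)
      hS.moduleCat_surjective_g

instance LeftComod.finiteDimensional_isSerreClass (k : Type u) [Field k] (C : Type u)
    [AddCommGroup C] [Module k C] [Coalgebra k C] :
    (LeftComod.finiteDimensional k C).IsSerreClass where
  exists_zero := ⟨LeftComod.zeroComod k C, (IsZero.iff_id_eq_zero _).2 (by
    ext1; apply LinearMap.ext; intro x; exact Subsingleton.elim (α := PUnit) _ _),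
    inferInstanceAs (Module.Finite k PUnit.{u + 1})⟩
  prop_of_mono f _ h := by
    have : Module.Finite k _ := h
    exact Module.Finite.of_injective (LeftComod.lin f) (LeftComod.injective_of_mono f)
  prop_of_epi f _ h := by
    have : Module.Finite k _ := h
    exact Module.Finite.of_surjective (LeftComod.lin f) (LeftComod.surjective_of_epi f)
  prop_X₂_of_shortExact {S} hS h₁ h₃ := by
    have : Module.Finite k S.X₁.carrier := h₁
    have : Module.Finite k S.X₃.carrier := h₃
    have := hS.mono_f
    have := hS.epi_g
    obtain ⟨l, hl⟩ : ∃ l, l ≫ S.f = LeftComod.kerι S.g :=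
      ⟨hS.exact.lift _ (LeftComod.kerι_comp S.g), hS.exact.lift_f _ _⟩
    have hex : Function.Exact (LeftComod.lin S.f) (LeftComod.lin S.g) := by
      refine fun x => ⟨fun hx => ⟨LeftComod.lin l ⟨x, hx⟩,
        LinearMap.congr_fun (congrArg LeftComod.lin hl) ⟨x, hx⟩⟩, ?_⟩
      rintro ⟨y, rfl⟩
      exact LinearMap.congr_fun (congrArg LeftComod.lin S.zero) y
    exact Module.Finite.of_exact hex (LeftComod.surjective_of_epi S.g)

/-! ### Calabi-Yau algebras and coalgebras -/

section calabiYau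

attribute [local instance] HasDerivedCategory.standard

/-- The bounded derived category of left `A`-modules with finite-dimensional cohomology. -/
abbrev DbfdMod (k : Type u) [Field k] (A : Type u) [Ring A] [Algebra k A] : Type (u + 1) :=
  (DerivedCategory.boundedCohomologyIn (ModuleCat.finiteDimensional k A)).FullSubcategory

/-- The bounded derived category of left `C`-comodules with finite-dimensional cohomology. -/
abbrev DbfdComod (k : Type u) [Field k] (C : Type u) [AddCommGroup C] [Module k C]
    [Coalgebra k C] : Type (u + 1) :=
  (DerivedCategory.boundedCohomologyIn (LeftComod.finiteDimensional k C)).FullSubcategory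

/-- A `k`-algebra is (left) Calabi-Yau of dimension `n` if the bounded derived category of left
modules with finite-dimensional cohomology is. -/
def Algebra.IsCalabiYau (k : Type u) [Field k] (A : Type u) [Ring A] [Algebra k A] (n : ℤ) :
    Prop :=
  IsCalabiYauCategory k (DbfdMod k A) n

/-- A `k`-coalgebra is left Calabi-Yau of dimension `n` if the bounded derived category of left
comodules with finite-dimensional cohomology is. -/
def Coalgebra.IsLeftCalabiYau (k : Type u) [Field k] (C : Type u) [AddCommGroup C] [Module k C]
    [Coalgebra k C] (n : ℤ) : Prop :=
  IsCalabiYauCategory k (DbfdComod k C) n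

end calabiYau

/-!
Linear duality `M ↦ M*` is a faithful exact contravariant functor from left `C`-comodules to left
`C*`-modules. It sends the regular comodule `C` to the regular module `C*` and is full on morphisms
into finite powers of `C`. The descending chain condition on left coideals makes `C*` left
noetherian. Hence finite-dimensional comodules have resolutions by finite powers of `C` and their
duals have the dual free resolutions, so that duality is fully faithful on the derived categories
over complexes with finite-dimensional cohomology; by dévissage on the cohomology, a complex of
modules with bounded finite-dimensional cohomology is the dual of such a complex of comodules. This
is a contravariant equivalence which changes the sign of the shifts, and the Calabi-Yau condition is
invariant under such equivalences.
-/

section contravariant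

variable {k : Type*} {T T' : Type*} [Category* T] [Category* T'] [Preadditive T] [Preadditive T']

/-- The opposite of a `k`-linear category is `k`-linear. A contravariant `k`-linear functor from
`T` to `T'` is a `k`-linear functor from `Tᵒᵖ` to `T'`. -/
instance oppositeLinear [Semiring k] [Linear k T] : Linear k Tᵒᵖ where
  homModule X Y := Equiv.module k (opEquiv X Y)
  smul_comp _ _ _ a f g := Quiver.Hom.unop_inj (Linear.comp_smul _ _ _ g.unop a f.unop)
  comp_smul _ _ _ f a g := Quiver.Hom.unop_inj (Linear.smul_comp _ _ _ a g.unop f.unop)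

instance op_linear [Semiring k] [Linear k T] [Linear k T'] (F : T ⥤ T') [F.Linear k] :
    F.op.Linear k where
  map_smul f a := congrArg Quiver.Hom.op (F.map_smul a f.unop)

instance leftOp_linear [Semiring k] [Linear k T] [Linear k T'] (F : T ⥤ T'ᵒᵖ) [F.Linear k] :
    F.leftOp.Linear k where
  map_smul f a := congrArg Quiver.Hom.unop (F.map_smul a f.unop)

section homEquiv

variable [CommSemiring k] [Linear k T] [Linear k T'] (F : Tᵒᵖ ⥤ T') [F.Additive] [F.Linear k]
  [F.Full] [F.Faithful]

/-- The action on morphisms of a fully faithful contravariant linear functor. -/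
noncomputable def contraHomEquiv (X Y : T) : (X ⟶ Y) ≃ₗ[k] (F.obj (.op Y) ⟶ F.obj (.op X)) :=
  LinearEquiv.ofBijective
    { toFun f := F.map f.op
      map_add' _ _ := F.map_add
      map_smul' a f := F.map_smul a f.op }
    ⟨fun _ _ h => Quiver.Hom.op_inj (F.map_injective h), fun g => by
      obtain ⟨f, rfl⟩ := F.map_surjective g
      exact ⟨f.unop, rfl⟩⟩

@[simp]
lemma contraHomEquiv_apply {X Y : T} (f : X ⟶ Y) :
    contraHomEquiv (k := k) F X Y f = F.map f.op := rfl

variable {F} [HasShift T ℤ] [HasShift T' ℤ] [∀ m : ℤ, (shiftFunctor T' m).Additive]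
  [∀ m : ℤ, (shiftFunctor T' m).Linear k] {n m : ℤ}

/-- If a fully faithful contravariant functor `F` turns the shift by `n` into the shift by
`m = -n`, then morphisms `Y ⟶ X⟦n⟧` correspond to morphisms `F X ⟶ (F Y)⟦n⟧`. -/
noncomputable def contraShiftedHomEquiv (e : (shiftFunctor T n).op ⋙ F ≅ F ⋙ shiftFunctor T' m)
    (hmn : m + n = 0) (X Y : T) :
    (Y ⟶ X⟦n⟧) ≃ₗ[k] (F.obj (.op X) ⟶ (F.obj (.op Y))⟦n⟧) :=
  contraHomEquiv F Y (X⟦n⟧) ≪≫ₗ Linear.homCongr k (e.app (.op X)) (Iso.refl (F.obj (.op Y))) ≪≫ₗ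
    LinearEquiv.ofBijective ((shiftFunctor T' n).mapLinearMap k)
      ⟨(shiftFunctor T' n).map_injective, (shiftFunctor T' n).map_surjective⟩ ≪≫ₗ
    Linear.homCongr k ((shiftFunctorCompIsoId T' m n hmn).app (F.obj (.op X))) (Iso.refl _)

lemma contraShiftedHomEquiv_apply (e : (shiftFunctor T n).op ⋙ F ≅ F ⋙ shiftFunctor T' m)
    (hmn : m + n = 0) {X Y : T} (f : Y ⟶ X⟦n⟧) :
    contraShiftedHomEquiv (k := k) e hmn X Y f =
      (shiftFunctorCompIsoId T' m n hmn).inv.app (F.obj (.op X)) ≫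
        (e.inv.app (.op X) ≫ F.map f.op)⟦n⟧' := by
  simp only [contraShiftedHomEquiv, LinearEquiv.trans_apply, Linear.homCongr_apply,
    contraHomEquiv_apply, Iso.refl_hom, Category.comp_id, Iso.app_inv]
  rfl

end homEquiv

variable [HasShift T ℤ] [HasShift T' ℤ]

/-- An inverse of a contravariant equivalence changing the sign of the shifts also changes the sign
of the shifts. -/
noncomputable def contraInverseShiftIso (F : Tᵒᵖ ⥤ T') [F.IsEquivalence] {n m : ℤ}
    (e : (shiftFunctor T m).op ⋙ F ≅ F ⋙ shiftFunctor T' n) :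
    (shiftFunctor T' n).op ⋙ F.inv.leftOp ≅ F.inv.leftOp ⋙ shiftFunctor T m := by
  let G := F.inv
  let c : G ⋙ F ≅ 𝟭 T' := F.asEquivalence.counitIso
  let u : F ⋙ G ≅ 𝟭 _ := F.asEquivalence.unitIso.symm
  let i : shiftFunctor T' n ⋙ G ≅ G ⋙ (shiftFunctor T m).op :=
    (Functor.leftUnitor _).symm ≪≫ Functor.isoWhiskerRight c.symm (shiftFunctor T' n ⋙ G) ≪≫
      Functor.isoWhiskerLeft G (Functor.isoWhiskerRight e.symm G) ≪≫
      Functor.isoWhiskerLeft (G ⋙ (shiftFunctor T m).op) u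
  exact
    { hom := NatTrans.leftOp i.inv
      inv := NatTrans.leftOp i.hom
      hom_inv_id := (NatTrans.leftOp_comp _ _).symm.trans (congrArg NatTrans.leftOp i.hom_inv_id)
      inv_hom_id := (NatTrans.leftOp_comp _ _).symm.trans (congrArg NatTrans.leftOp i.inv_hom_id) }

namespace IsCalabiYauCategory

variable [Field k] [Linear k T] [Linear k T'] [HasZeroObject T]
  [∀ m : ℤ, (shiftFunctor T m).Additive] [Pretriangulated T] [IsTriangulated T]
  [HasZeroObject T'] [∀ m : ℤ, (shiftFunctor T' m).Additive]
  [Pretriangulated T'] [IsTriangulated T'] (F : Tᵒᵖ ⥤ T') [F.Additive] [F.Linear k]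

lemma of_contravariant [F.Full] [F.Faithful] [∀ m : ℤ, (shiftFunctor T' m).Linear k] {n m : ℤ}
    (e : (shiftFunctor T n).op ⋙ F ≅ F ⋙ shiftFunctor T' m) (hmn : m + n = 0)
    (h : IsCalabiYauCategory k T' n) : IsCalabiYauCategory k T n := by
  obtain ⟨η, hη₁, hη₂⟩ := h.exists_duality
  let φ (X Y : T) := contraHomEquiv (k := k) F X Y
  let τ (X Y : T) := contraShiftedHomEquiv (k := k) e hmn X Y
  refine ⟨fun X Y => ?_, fun X Y => φ X Y ≪≫ₗ η _ _ ≪≫ₗ (τ X Y).dualMap, ?_, ?_⟩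
  · have := h.hom_finite (F.obj (.op Y)) (F.obj (.op X))
    exact Module.Finite.equiv (φ X Y).symm
  · intro X Y Y' f g h
    have hτ : τ X Y (g ≫ h) = τ X Y' h ≫ (F.map g.op)⟦n⟧' := by
      simp [τ, contraShiftedHomEquiv_apply]
    simp [φ, hη₂, hτ]
  · intro X' X Y a f h
    have hτ : τ X Y (h ≫ a⟦n⟧') = F.map a.op ≫ τ X' Y h := by
      have h₁ := (shiftFunctorCompIsoId T' m n hmn).inv.naturality (F.map a.op)
      have h₂ := e.inv.naturality a.op
      dsimp at h₁ h₂
      simp [τ, contraShiftedHomEquiv_apply, reassoc_of% h₁, ← Functor.map_comp, reassoc_of% h₂]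
    simp [φ, hη₁, hτ]

lemma iff_of_contravariant [F.IsEquivalence] [∀ m : ℤ, (shiftFunctor T m).Linear k]
    [∀ m : ℤ, (shiftFunctor T' m).Linear k]
    (e : ∀ n m : ℤ, m + n = 0 → ((shiftFunctor T n).op ⋙ F ≅ F ⋙ shiftFunctor T' m)) (n : ℤ) :
    IsCalabiYauCategory k T n ↔ IsCalabiYauCategory k T' n := by
  have : F.asEquivalence.functor.Additive := inferInstanceAs F.Additive
  have : F.inv.Additive := inferInstanceAs F.asEquivalence.inverse.Additive
  have : F.asEquivalence.functor.Linear k := inferInstanceAs (F.Linear k)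
  have : F.inv.Linear k := inferInstanceAs (F.asEquivalence.inverse.Linear k)
  exact ⟨of_contravariant F.inv.leftOp (contraInverseShiftIso F (e (-n) n (by lia))) (by lia),
    of_contravariant F (e n (-n) (by lia)) (by lia)⟩

end IsCalabiYauCategory

end contravariant

section contraComplex

variable {A : Type*} [Category* A] [Abelian A] {B : Type*} [Category* B] [Abelian B]
  (Φ : Aᵒᵖ ⥤ B) [Φ.Additive]

/-- The functor on cochain complexes induced by a contravariant functor `Φ`: it sends `K` to the
complex with `Φ (K⁻ⁱ)` in degree `i`. -/
noncomputable def contraComplex : (CochainComplex A ℤ)ᵒᵖ ⥤ CochainComplex B ℤ :=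
  (CochainComplex.opEquivalence A).functor ⋙ Φ.mapHomologicalComplex (.up ℤ)

@[simp]
lemma contraComplex_obj_d (K : (CochainComplex A ℤ)ᵒᵖ) (i j : ℤ) :
    ((contraComplex Φ).obj K).d i j = Φ.map (K.unop.d (-j) (-i)).op := rfl

instance contraComplex_additive : (contraComplex Φ).Additive where
  map_add {K L f g} := by
    ext i
    exact Φ.map_add (f := (f.unop.f (-i)).op) (g := (g.unop.f (-i)).op)

instance contraComplex_linear {k : Type*} [Semiring k] [Linear k A] [Linear k B] [Φ.Linear k] :
    (contraComplex Φ).Linear k where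
  map_smul f a := by
    ext i
    exact Φ.map_smul a (f.unop.f (-i)).op

lemma map_units_smul_op {X Y : A} (ε : ℤˣ) (f : X ⟶ Y) :
    Φ.map (ε • f).op = ε • Φ.map f.op := by
  obtain rfl | rfl := Int.units_eq_one_or ε
  · simp
  · simp [Units.smul_def]

/-- The functor on cochain complexes induced by a contravariant functor changes the sign of the
shifts. -/
noncomputable def contraComplexShiftIso {n m : ℤ} (h : m + n = 0) :
    (shiftFunctor (CochainComplex A ℤ) n).op ⋙ contraComplex Φ ≅
      contraComplex Φ ⋙ shiftFunctor (CochainComplex B ℤ) m :=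
  NatIso.ofComponents (fun K => HomologicalComplex.Hom.isoOfComponents
    (fun i => Φ.mapIso (K.unop.XIsoOfEq (show -(i + m) = -i + n by lia)).op) (by
      intro i j _
      obtain rfl : m = -n := by lia
      change Φ.map (K.unop.XIsoOfEq _).hom.op ≫
          ((-n).negOnePow • Φ.map (K.unop.d (-(j + -n)) (-(i + -n))).op) =
        Φ.map (n.negOnePow • K.unop.d (-j + n) (-i + n)).op ≫ Φ.map (K.unop.XIsoOfEq _).hom.op
      rw [map_units_smul_op, Linear.comp_units_smul, Linear.units_smul_comp, ← Φ.map_comp,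
        ← Φ.map_comp, ← op_comp, ← op_comp, HomologicalComplex.XIsoOfEq_hom_comp_d,
        HomologicalComplex.d_comp_XIsoOfEq_hom, Int.negOnePow_neg])) (by
      intro K L f
      ext i
      change Φ.map (f.unop.f (-i + n)).op ≫ Φ.map (L.unop.XIsoOfEq _).hom.op =
        Φ.map (K.unop.XIsoOfEq _).hom.op ≫ Φ.map (f.unop.f (-(i + m))).op
      rw [← Φ.map_comp, ← op_comp, ← Φ.map_comp, ← op_comp,
        HomologicalComplex.XIsoOfEq_hom_naturality])

variable [PreservesFiniteLimits Φ] [PreservesFiniteColimits Φ]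

/-- An exact contravariant functor commutes with the homology of cochain complexes, up to the sign
of the degree. -/
noncomputable def contraComplexHomologyIso (K : CochainComplex A ℤ) (i : ℤ) :
    ((contraComplex Φ).obj (.op K)).homology i ≅ Φ.obj (.op (K.homology (-i))) :=
  ShortComplex.homologyMapIso
      (((contraComplex Φ).obj (.op K)).isoSc' (i - 1) i (i + 1) (by simp) (by simp)) ≪≫
    ShortComplex.mapHomologyIso (K.sc' (-(i + 1)) (-i) (-(i - 1))).op Φ ≪≫
    Φ.mapIso (ShortComplex.homologyOpIso _ ≪≫ (ShortComplex.homologyMapIso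
      (K.isoSc' (-(i + 1)) (-i) (-(i - 1)) (by simp; lia) (by simp; lia))).op)

instance quasiIso_contraComplex_map {K L : (CochainComplex A ℤ)ᵒᵖ} (f : K ⟶ L)
    [QuasiIso f.unop] : QuasiIso ((contraComplex Φ).map f) := by
  rw [quasiIso_iff]
  intro i
  rw [quasiIsoAt_iff' _ (i - 1) i (i + 1) (by simp) (by simp)]
  have h : QuasiIsoAt f.unop (-i) := inferInstance
  rw [quasiIsoAt_iff' _ (-(i + 1)) (-i) (-(i - 1)) (by simp; lia) (by simp; lia),
    ← ShortComplex.quasiIso_opMap_iff] at h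
  exact ShortComplex.quasiIso_map_of_preservesLeftHomology Φ (ShortComplex.opMap
    ((HomologicalComplex.shortComplexFunctor' A (.up ℤ) (-(i + 1)) (-i) (-(i - 1))).map f.unop))

end contraComplex

section contraDerived

open DerivedCategory

variable {A : Type*} [Category* A] [Abelian A] {B : Type*} [Category* B] [Abelian B]
  [HasDerivedCategory.{v} A] [HasDerivedCategory.{w} B]
  (Φ : Aᵒᵖ ⥤ B) [Φ.Additive] [PreservesFiniteLimits Φ] [PreservesFiniteColimits Φ]

omit [HasDerivedCategory.{v} A] in
lemma quasiIso_op_isInvertedBy_contraComplex_comp_Q :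
    (HomologicalComplex.quasiIso A (.up ℤ)).op.IsInvertedBy (contraComplex Φ ⋙ Q) := by
  intro K L f hf
  have : QuasiIso f.unop := hf
  exact inferInstanceAs (IsIso (Q.map ((contraComplex Φ).map f)))

/-- The contravariant functor between derived categories induced by an exact contravariant
functor. -/
noncomputable def contraDerived : (DerivedCategory A)ᵒᵖ ⥤ DerivedCategory B :=
  Localization.lift _ (quasiIso_op_isInvertedBy_contraComplex_comp_Q Φ) (Q (C := A)).op

/-- `contraDerived Φ` is computed by applying `contraComplex Φ` to a representing complex. -/
noncomputable def contraDerivedFactors :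
    (Q (C := A)).op ⋙ contraDerived Φ ≅ contraComplex Φ ⋙ Q :=
  Localization.fac _ (quasiIso_op_isInvertedBy_contraComplex_comp_Q Φ) _

lemma contraDerived_map_Q_map {K L : CochainComplex A ℤ} (f : K ⟶ L) :
    (contraDerived Φ).map (Q.map f).op = (contraDerivedFactors Φ).hom.app (.op L) ≫
      Q.map ((contraComplex Φ).map f.op) ≫ (contraDerivedFactors Φ).inv.app (.op K) := by
  have := (contraDerivedFactors Φ).hom.naturality f.op
  dsimp at this
  simp [← reassoc_of% this]

/-- The functor `contraDerived Φ` as a localization of a functor on the homotopy category. -/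
noncomputable def quotientCompQhCompContraDerivedIso :
    (HomotopyCategory.quotient A (.up ℤ)).op ⋙ Qh.op ⋙ contraDerived Φ ≅ contraComplex Φ ⋙ Q :=
  Functor.isoWhiskerRight (NatIso.op (quotientCompQhIso A).symm) (contraDerived Φ) ≪≫
    contraDerivedFactors Φ

instance contraDerived_additive : (contraDerived Φ).Additive := by
  have : ((HomotopyCategory.quotient A (.up ℤ)).op ⋙ Qh.op ⋙ contraDerived Φ).Additive :=
    Functor.additive_of_iso (quotientCompQhCompContraDerivedIso Φ).symm
  have := Functor.additive_of_full_essSurj_comp (HomotopyCategory.quotient A (.up ℤ)).op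
    (Qh.op ⋙ contraDerived Φ)
  exact (Localization.functor_additive_iff Qh.op (HomotopyCategory.quasiIso A (.up ℤ)).op _).2 this

instance contraDerived_linear {k : Type*} [Ring k] [Linear k A] [Linear k B] [Φ.Linear k] :
    (contraDerived Φ).Linear k := by
  have : Functor.Linear k
      ((HomotopyCategory.quotient A (.up ℤ)).op ⋙ Qh.op ⋙ contraDerived Φ) :=
    Functor.linear_of_iso k (quotientCompQhCompContraDerivedIso Φ).symm
  have : Functor.Linear k (Qh.op ⋙ contraDerived Φ) :=
    Functor.linear_of_full_essSurj_comp (HomotopyCategory.quotient A (.up ℤ)).op _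
  exact (Localization.functor_linear_iff Qh.op (HomotopyCategory.quasiIso A (.up ℤ)).op k
    (Qh.op ⋙ contraDerived Φ) (contraDerived Φ)).1 this

/-- The contravariant functor between derived categories induced by an exact contravariant functor
changes the sign of the shifts. -/
noncomputable def contraDerivedShiftIso {n m : ℤ} (h : m + n = 0) :
    (shiftFunctor (DerivedCategory A) n).op ⋙ contraDerived Φ ≅
      contraDerived Φ ⋙ shiftFunctor (DerivedCategory B) m :=
  letI W := (HomologicalComplex.quasiIso A (.up ℤ)).op
  letI L := (Q (C := A)).op
  letI : Localization.Lifting L W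
      (((shiftFunctor (CochainComplex A ℤ) n).op ⋙ contraComplex Φ) ⋙ Q)
      ((shiftFunctor (DerivedCategory A) n).op ⋙ contraDerived Φ) :=
    ⟨Functor.isoWhiskerRight (NatIso.op (Q.commShiftIso n)) (contraDerived Φ) ≪≫
      Functor.isoWhiskerLeft (shiftFunctor (CochainComplex A ℤ) n).op (contraDerivedFactors Φ)⟩
  letI : Localization.Lifting L W ((contraComplex Φ ⋙ shiftFunctor (CochainComplex B ℤ) m) ⋙ Q)
      (contraDerived Φ ⋙ shiftFunctor (DerivedCategory B) m) :=
    ⟨Functor.isoWhiskerRight (contraDerivedFactors Φ) (shiftFunctor (DerivedCategory B) m) ≪≫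
      Functor.isoWhiskerLeft (contraComplex Φ) (Q.commShiftIso m).symm⟩
  Localization.liftNatIso L W _ _ _ _ (Functor.isoWhiskerRight (contraComplexShiftIso Φ h) Q)

lemma nonempty_homology_contraDerived_iso (X : DerivedCategory A) {i j : ℤ} (h : i + j = 0) :
    Nonempty ((homologyFunctor B i).obj ((contraDerived Φ).obj (.op X)) ≅
      Φ.obj (.op ((homologyFunctor A j).obj X))) := by
  obtain rfl : j = -i := by lia
  obtain ⟨K, ⟨e⟩⟩ : ∃ K, Nonempty (Q.obj K ≅ X) := ⟨_, ⟨Q.objObjPreimageIso X⟩⟩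
  exact ⟨(homologyFunctor B i).mapIso ((contraDerived Φ).mapIso e.op ≪≫
      (contraDerivedFactors Φ).app (.op K)) ≪≫ (homologyFunctorFactors B i).app _ ≪≫
      contraComplexHomologyIso Φ K i ≪≫
      Φ.mapIso ((homologyFunctor A (-i)).mapIso e.symm ≪≫ (homologyFunctorFactors A (-i)).app K).op⟩

end contraDerived

section devissage

open DerivedCategory Pretriangulated Triangulated ZeroObject

variable {A : Type*} [Category* A] [Abelian A] [HasDerivedCategory.{w} A]

section truncationTriangle

variable (P : ObjectProperty A) [P.IsSerreClass] {T : Triangle (DerivedCategory A)}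
  (hT : T ∈ distTriang (DerivedCategory A)) (a : ℤ) [T.obj₁.IsLE a] [T.obj₃.IsGE (a + 1)]
include hT a

lemma prop_homology_obj₁_of_isLE_of_isGE {i : ℤ} (h : P ((homologyFunctor A i).obj T.obj₂)) :
    P ((homologyFunctor A i).obj T.obj₁) := by
  by_cases hi : i ≤ a
  · exact P.prop_X₂_of_exact (HomologySequence.exact₁ _ hT (i - 1) i (by lia))
      (P.prop_of_isZero (T.obj₃.isZero_of_isGE (a + 1) (i - 1) (by lia))) h
  · exact P.prop_of_isZero (T.obj₁.isZero_of_isLE a i (by lia))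

lemma prop_homology_obj₃_of_isLE_of_isGE {i : ℤ} (h : P ((homologyFunctor A i).obj T.obj₂)) :
    P ((homologyFunctor A i).obj T.obj₃) := by
  by_cases hi : i ≤ a
  · exact P.prop_of_isZero (T.obj₃.isZero_of_isGE (a + 1) i (by lia))
  · exact P.prop_X₂_of_exact (HomologySequence.exact₃ _ hT i (i + 1) (by lia)) h
      (P.prop_of_isZero (T.obj₁.isZero_of_isLE a (i + 1) (by lia)))

lemma isGE_obj₁_of_isLE_of_isGE (n : ℤ) [T.obj₂.IsGE n] : T.obj₁.IsGE n :=
  (isGE_iff _ _).2 fun i hi =>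
    prop_homology_obj₁_of_isLE_of_isGE (IsZero (C := A)) hT a (T.obj₂.isZero_of_isGE n i hi)

lemma isLE_obj₃_of_isLE_of_isGE (n : ℤ) [T.obj₂.IsLE n] : T.obj₃.IsLE n :=
  (isLE_iff _ _).2 fun i hi =>
    prop_homology_obj₃_of_isLE_of_isGE (IsZero (C := A)) hT a (T.obj₂.isZero_of_isLE n i hi)

end truncationTriangle

variable (P : ObjectProperty A) [P.IsSerreClass] (R : ObjectProperty (DerivedCategory A))
  [R.IsClosedUnderIsomorphisms]

lemma prop_of_isGE_of_isLE_of_prop_singleFunctor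
    (hR : ∀ (n : ℤ) (M : A), P M → R ((singleFunctor A n).obj M))
    {X : DerivedCategory A} (n : ℤ) [X.IsGE n] [X.IsLE n] (hX : cohomologyIn P X) : R X := by
  obtain ⟨M, ⟨e⟩⟩ := X.exists_iso_singleFunctor_obj_of_isGE_of_isLE n
  exact R.prop_of_iso e.symm (hR n M (P.prop_of_iso ((homologyFunctor A n).mapIso e ≪≫
    (singleFunctorCompHomologyFunctorIso A n).app M) (hX n)))

/-- Induct on the cohomological amplitude, splitting off the lowest cohomology object. -/
lemma boundedCohomologyIn_le [R.IsTriangulatedClosed₂]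
    (hR : ∀ (n : ℤ) (M : A), P M → R ((singleFunctor A n).obj M)) :
    boundedCohomologyIn P ≤ R := by
  suffices h : ∀ (d : ℕ) (X : DerivedCategory A) (a : ℤ), X.IsGE a → X.IsLE (a + d) →
      cohomologyIn P X → R X by
    rintro X ⟨⟨⟨a, ha⟩, ⟨b, hb⟩⟩, hX⟩
    exact h (b - a).toNat X a ha (TStructure.t.isLE_of_le X b _ (by lia)) hX
  intro d
  induction d with
  | zero =>
    intro X a _ hXa hX
    have : X.IsLE a := by simpa only [Nat.cast_zero, add_zero] using hXa
    exact prop_of_isGE_of_isLE_of_prop_singleFunctor P R hR a hX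
  | succ d ih =>
    intro X a _ _ hX
    obtain ⟨X₁, X₃, h₁, h₃, f, g, δ, hT⟩ := TStructure.t.exists_triangle X a (a + 1) rfl
    let T := Triangle.mk f g δ
    have : T.obj₁.IsLE a := ⟨h₁⟩
    have : T.obj₃.IsGE (a + 1) := ⟨h₃⟩
    have : T.obj₂.IsGE a := inferInstanceAs (X.IsGE a)
    have : T.obj₂.IsLE (a + (d + 1 : ℕ)) := inferInstanceAs (X.IsLE _)
    have : T.obj₁.IsGE a := isGE_obj₁_of_isLE_of_isGE hT a a
    have hX₃ : T.obj₃.IsLE (a + 1 + d) := by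
      have := isLE_obj₃_of_isLE_of_isGE hT a (a + (d + 1 : ℕ))
      rwa [Nat.cast_add, Nat.cast_one, add_comm (d : ℤ), ← add_assoc] at this
    exact R.ext_of_isTriangulatedClosed₂ T hT
      (prop_of_isGE_of_isLE_of_prop_singleFunctor P R hR a
        fun i => prop_homology_obj₁_of_isLE_of_isGE P hT a (hX i))
      (ih T.obj₃ (a + 1) inferInstance hX₃
        fun i => prop_homology_obj₃_of_isLE_of_isGE P hT a (hX i))

end devissage

section representedBy

open DerivedCategory Pretriangulated

variable {A : Type*} [Category* A] [Abelian A] [HasDerivedCategory.{w} A]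
  (𝓚 : ObjectProperty (CochainComplex A ℤ))

/-- The objects of the derived category that are represented by a complex in the class `𝓚`. -/
def representedBy : ObjectProperty (DerivedCategory A) :=
  fun X => ∃ K, 𝓚 K ∧ Nonempty (Q.obj K ≅ X)

instance representedBy_isClosedUnderIsomorphisms :
    (representedBy 𝓚).IsClosedUnderIsomorphisms where
  of_iso e := by
    rintro ⟨K, hK, ⟨e'⟩⟩
    exact ⟨K, hK, ⟨e' ≪≫ e⟩⟩

/-- The middle object of a triangle is the cone of the connecting morphism `X₃⟦-1⟧ ⟶ X₁`, which is
represented by a morphism of complexes. -/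
lemma representedBy_isTriangulatedClosed₂
    (hshift : ∀ (K : CochainComplex A ℤ) (n : ℤ), 𝓚 K → 𝓚 (K⟦n⟧))
    (hcone : ∀ {K L : CochainComplex A ℤ} (f : K ⟶ L), 𝓚 K → 𝓚 L →
      𝓚 (CochainComplex.mappingCone f))
    (hfull : ∀ {K L : CochainComplex A ℤ}, 𝓚 K → 𝓚 L →
      Function.Surjective (Q.map : (K ⟶ L) → (Q.obj K ⟶ Q.obj L))) :
    (representedBy 𝓚).IsTriangulatedClosed₂ := .mk' <| by
  rintro T hT ⟨K₁, hK₁, ⟨e₁⟩⟩ ⟨K₃, hK₃, ⟨e₃⟩⟩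
  let e₃' : Q.obj (K₃⟦(-1 : ℤ)⟧) ≅ T.obj₃⟦(-1 : ℤ)⟧ :=
    (Q.commShiftIso (-1 : ℤ)).app K₃ ≪≫ (shiftFunctor _ (-1 : ℤ)).mapIso e₃
  obtain ⟨φ, hφ⟩ := hfull (hshift K₃ (-1) hK₃) hK₁ (e₃'.hom ≫ T.invRotate.mor₁ ≫ e₁.inv)
  have comm : Q.map φ ≫ e₁.hom = e₃'.hom ≫ T.invRotate.mor₁ := by
    rw [hφ, Category.assoc]
    exact congrArg (e₃'.hom ≫ ·) (e₁.symm.comp_inv_eq.2 rfl)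
  exact ⟨_, hcone φ (hshift K₃ (-1) hK₃) hK₁, ⟨Triangle.π₃.mapIso (isoTriangleOfIso₁₂ _ _
    (mappingCone_triangle_distinguished φ) (inv_rot_of_distTriang _ hT) e₃' e₁ comm)⟩⟩

end representedBy

section homotopicallyInjectiveProjective

open DerivedCategory

variable {A : Type*} [Category* A] [Abelian A] [HasDerivedCategory.{w} A]

lemma Q_map_surjective_of_Qh_map_surjective {K L : CochainComplex A ℤ}
    (h : Function.Surjective (Qh.map : ((HomotopyCategory.quotient A (.up ℤ)).obj K ⟶
      (HomotopyCategory.quotient A (.up ℤ)).obj L) → _)) :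
    Function.Surjective (Q.map : (K ⟶ L) → (Q.obj K ⟶ Q.obj L)) := by
  intro g
  obtain ⟨f, hf⟩ := h
    ((quotientCompQhIso A).hom.app K ≫ g ≫ (quotientCompQhIso A).inv.app L)
  obtain ⟨f, rfl⟩ := (HomotopyCategory.quotient _ _).map_surjective f
  refine ⟨f, ?_⟩
  rw [← cancel_epi ((quotientCompQhIso A).hom.app K), ← quotientCompQhIso_hom_naturality, hf,
    Category.assoc, Category.assoc, Iso.inv_hom_id_app]
  exact congrArg _ (Category.comp_id g)

lemma Q_map_surjective_of_isKInjective (K L : CochainComplex A ℤ) [L.IsKInjective] :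
    Function.Surjective (Q.map : (K ⟶ L) → (Q.obj K ⟶ Q.obj L)) :=
  Q_map_surjective_of_Qh_map_surjective
    (CochainComplex.IsKInjective.Qh_map_bijective _ L).surjective

lemma Q_map_surjective_of_isKProjective (K L : CochainComplex A ℤ) [K.IsKProjective] :
    Function.Surjective (Q.map : (K ⟶ L) → (Q.obj K ⟶ Q.obj L)) :=
  Q_map_surjective_of_Qh_map_surjective
    (CochainComplex.IsKProjective.Qh_map_bijective K _).surjective

lemma nonempty_homotopy_of_isKProjective {K L : CochainComplex A ℤ} [K.IsKProjective]
    {f g : K ⟶ L} (h : Q.map f = Q.map g) : Nonempty (Homotopy f g) := by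
  refine ⟨HomotopyCategory.homotopyOfEq _ _
    ((CochainComplex.IsKProjective.Qh_map_bijective K _).injective ?_)⟩
  rw [← cancel_mono ((quotientCompQhIso A).hom.app L), quotientCompQhIso_hom_naturality,
    quotientCompQhIso_hom_naturality, h]

end homotopicallyInjectiveProjective

section splice

variable {A : Type*} [Category* A] [Abelian A] {Z X : ℕ → A} {i : ∀ n, Z n ⟶ X n}
  {p : ∀ n, X n ⟶ Z (n + 1)} (w : ∀ n, i n ≫ p n = 0)

section

include w

lemma splice_comp_d (n : ℕ) : i n ≫ p n ≫ i (n + 1) = 0 := by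
  rw [reassoc_of% w n, zero_comp]

lemma splice_d_comp_d (n : ℕ) : (p n ≫ i (n + 1)) ≫ p (n + 1) ≫ i (n + 2) = 0 := by
  rw [Category.assoc, splice_comp_d w, comp_zero]

end

lemma splice_comp_d_exact [∀ n, Mono (i n)] (hex : ∀ n, (ShortComplex.mk _ _ (w n)).Exact)
    (n : ℕ) : (ShortComplex.mk _ _ (splice_comp_d w n)).Exact := by
  let α : ShortComplex.mk _ _ (w n) ⟶ ShortComplex.mk _ _ (splice_comp_d w n) :=
    { τ₁ := 𝟙 _, τ₂ := 𝟙 _, τ₃ := i (n + 1) }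
  exact (ShortComplex.exact_iff_of_epi_of_isIso_of_mono α).1 (hex n)

lemma splice_d_comp_d_exact [∀ n, Mono (i n)] [∀ n, Epi (p n)]
    (hex : ∀ n, (ShortComplex.mk _ _ (w n)).Exact) (n : ℕ) :
    (ShortComplex.mk _ _ (splice_d_comp_d w n)).Exact := by
  let α : ShortComplex.mk _ _ (splice_d_comp_d w n) ⟶
      ShortComplex.mk _ _ (splice_comp_d w (n + 1)) :=
    { τ₁ := p n, τ₂ := 𝟙 _, τ₃ := 𝟙 _ }
  exact (ShortComplex.exact_iff_of_epi_of_isIso_of_mono α).2 (splice_comp_d_exact w hex (n + 1))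

/-- The Yoneda splice `X 0 ⟶ X 1 ⟶ ⋯` of the sequences `Z n ⟶ X n ⟶ Z (n + 1)`. -/
noncomputable def spliceComplex : CochainComplex A ℕ :=
  CochainComplex.of X (fun n => p n ≫ i (n + 1)) (splice_d_comp_d w)

lemma spliceComplex_d (n : ℕ) : (spliceComplex w).d n (n + 1) = p n ≫ i (n + 1) :=
  CochainComplex.of_d X (fun n => p n ≫ i (n + 1)) n

/-- The augmentation of `spliceComplex w` given by `i 0`. -/
noncomputable def spliceAugmentation :
    (CochainComplex.single₀ A).obj (Z 0) ⟶ spliceComplex w :=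
  (CochainComplex.fromSingle₀Equiv _ _).symm
    ⟨i 0, (congrArg _ (spliceComplex_d w 0)).trans (splice_comp_d w 0)⟩

lemma spliceAugmentation_f_zero : (spliceAugmentation w).f 0 = i 0 :=
  CochainComplex.fromSingle₀Equiv_symm_apply_f_zero _ _

variable [∀ n, Mono (i n)] (hex : ∀ n, (ShortComplex.mk _ _ (w n)).Exact)
include hex

lemma quasiIsoAt_spliceAugmentation_zero : QuasiIsoAt (spliceAugmentation w) 0 := by
  rw [CochainComplex.quasiIsoAt₀_iff, ShortComplex.quasiIso_iff_of_zeros]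
  rotate_left
  · rfl
  · rfl
  · rfl
  refine (ShortComplex.exact_and_mono_f_iff_of_iso ?_).2
    ⟨splice_comp_d_exact w hex 0, inferInstanceAs (Mono (i 0))⟩
  refine ShortComplex.isoMk (Iso.refl _) (Iso.refl _) (Iso.refl _) ?_ ?_
  · exact (Category.id_comp _).trans
      ((spliceAugmentation_f_zero w).symm.trans (Category.comp_id _).symm)
  · exact (Category.id_comp _).trans
      ((spliceComplex_d w 0).symm.trans (Category.comp_id _).symm)

variable [∀ n, Epi (p n)]

lemma quasiIsoAt_spliceAugmentation_succ (n : ℕ) :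
    QuasiIsoAt (spliceAugmentation w) (n + 1) := by
  rw [quasiIsoAt_iff_exactAt _ _ (CochainComplex.exactAt_succ_single_obj _ _),
    HomologicalComplex.exactAt_iff' _ n (n + 1) (n + 1 + 1) (by simp) (by simp)]
  refine (ShortComplex.exact_iff_of_iso ?_).2 (splice_d_comp_d_exact w hex n)
  exact ShortComplex.isoMk (Iso.refl _) (Iso.refl _) (Iso.refl _)
    ((Category.id_comp _).trans ((spliceComplex_d w n).symm.trans (Category.comp_id _).symm))
    ((Category.id_comp _).trans
      ((spliceComplex_d w (n + 1)).symm.trans (Category.comp_id _).symm))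

lemma quasiIso_spliceAugmentation : QuasiIso (spliceAugmentation w) where
  quasiIsoAt
    | 0 => quasiIsoAt_spliceAugmentation_zero w hex
    | n + 1 => quasiIsoAt_spliceAugmentation_succ w hex n

end splice

section injectiveResolution

variable {A : Type*} [Category* A] [Abelian A]

/-- Splice the short exact sequences obtained by embedding the successive cokernels. -/
lemma exists_injectiveResolution_of_embeddings (S E : ObjectProperty A)
    (hE : ∀ X, E X → Injective X)
    (hS : ∀ Z, S Z → ∃ (J : A) (j : Z ⟶ J), E J ∧ Mono j ∧ S (cokernel j)) (M : A) (hM : S M) :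
    ∃ R : InjectiveResolution M, ∀ n, E (R.cocomplex.X n) := by
  choose J j hJ hj hcok using hS
  let Z : ℕ → { Z : A // S Z } := fun n =>
    Nat.rec ⟨M, hM⟩ (fun _ Z => ⟨cokernel (j Z.1 Z.2), hcok Z.1 Z.2⟩) n
  let X (n : ℕ) : A := J (Z n).1 (Z n).2
  let i (n : ℕ) : (Z n).1 ⟶ X n := j (Z n).1 (Z n).2
  let p (n : ℕ) : X n ⟶ (Z (n + 1)).1 := cokernel.π (i n)
  have w (n : ℕ) : i n ≫ p n = 0 := cokernel.condition _
  have : ∀ n, Mono (i n) := fun n => hj _ _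
  have : ∀ n, Epi (p n) := fun n => inferInstanceAs (Epi (cokernel.π _))
  have hex (n : ℕ) : (ShortComplex.mk _ _ (w n)).Exact :=
    ShortComplex.exact_of_g_is_cokernel _ (cokernelIsCokernel _)
  exact ⟨{ cocomplex := spliceComplex w
           injective := fun n => hE _ (hJ (Z n).1 (Z n).2)
           ι := spliceAugmentation w
           quasiIso := quasiIso_spliceAugmentation w hex }, fun n => hJ (Z n).1 (Z n).2⟩

end injectiveResolution

section boundedComplexes

variable {A : Type*} [Category* A] [Abelian A] (E : ObjectProperty A)

/-- The bounded below complexes with terms in `E`. -/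
def boundedBelowIn : ObjectProperty (CochainComplex A ℤ) :=
  fun K => (∃ a, K.IsStrictlyGE a) ∧ ∀ i, E (K.X i)

/-- The bounded above complexes with terms in `E`. -/
def boundedAboveIn : ObjectProperty (CochainComplex A ℤ) :=
  fun K => (∃ a, K.IsStrictlyLE a) ∧ ∀ i, E (K.X i)

variable {E} {K L : CochainComplex A ℤ}

lemma boundedBelowIn.shift (hK : boundedBelowIn E K) (n : ℤ) : boundedBelowIn E (K⟦n⟧) := by
  obtain ⟨⟨a, _⟩, hK⟩ := hK
  exact ⟨⟨a - n, K.isStrictlyGE_shift a n (a - n) (by lia)⟩, fun i => hK (i + n)⟩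

lemma boundedAboveIn.shift (hK : boundedAboveIn E K) (n : ℤ) : boundedAboveIn E (K⟦n⟧) := by
  obtain ⟨⟨a, _⟩, hK⟩ := hK
  exact ⟨⟨a - n, K.isStrictlyLE_shift a n (a - n) (by lia)⟩, fun i => hK (i + n)⟩

section mappingCone

variable [E.IsClosedUnderIsomorphisms] (hE : ∀ X Y, E X → E Y → E (X ⊞ Y)) (f : K ⟶ L)
include hE

lemma prop_mappingCone_X (hK : ∀ i, E (K.X i)) (hL : ∀ i, E (L.X i)) (i : ℤ) :
    E ((CochainComplex.mappingCone f).X i) :=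
  E.prop_of_iso (HomologicalComplex.homotopyCofiber.XIsoBiprod f i (i + 1) rfl).symm
    (hE _ _ (hK _) (hL _))

lemma boundedBelowIn.mappingCone (hK : boundedBelowIn E K) (hL : boundedBelowIn E L) :
    boundedBelowIn E (CochainComplex.mappingCone f) := by
  obtain ⟨⟨a, _⟩, hK⟩ := hK
  obtain ⟨⟨b, _⟩, hL⟩ := hL
  exact ⟨⟨min (a - 1) b, CochainComplex.isStrictlyGE_mappingCone f a b _⟩,
    prop_mappingCone_X hE f hK hL⟩

lemma boundedAboveIn.mappingCone (hK : boundedAboveIn E K) (hL : boundedAboveIn E L) :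
    boundedAboveIn E (CochainComplex.mappingCone f) := by
  obtain ⟨⟨a, _⟩, hK⟩ := hK
  obtain ⟨⟨b, _⟩, hL⟩ := hL
  refine ⟨⟨max a b, (CochainComplex.isStrictlyLE_iff _ _).2 fun i hi => ?_⟩,
    prop_mappingCone_X hE f hK hL⟩
  rw [CochainComplex.mappingCone.isZero_X_iff]
  exact ⟨K.isZero_of_isStrictlyLE a _ (by lia), L.isZero_of_isStrictlyLE b _ (by lia)⟩

end mappingCone

lemma boundedBelowIn.isKInjective (hK : boundedBelowIn E K) (hE : ∀ X, E X → Injective X) :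
    K.IsKInjective := by
  obtain ⟨⟨a, _⟩, hK⟩ := hK
  have (n : ℤ) := hE _ (hK n)
  exact CochainComplex.isKInjective_of_injective K a

lemma boundedAboveIn.isKProjective (hK : boundedAboveIn E K) (hE : ∀ X, E X → Projective X) :
    K.IsKProjective := by
  obtain ⟨⟨a, _⟩, hK⟩ := hK
  have (n : ℤ) := hE _ (hK n)
  exact CochainComplex.isKProjective_of_projective K a

lemma boundedBelowIn_cochainComplex [E.IsClosedUnderIsomorphisms]
    (h0 : ∀ X, IsZero X → E X) {M : A} (R : InjectiveResolution M)
    (hR : ∀ n, E (R.cocomplex.X n)) : boundedBelowIn E R.cochainComplex := by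
  refine ⟨⟨0, inferInstance⟩, fun i => ?_⟩
  by_cases hi : 0 ≤ i
  · obtain ⟨j, rfl⟩ := Int.eq_ofNat_of_zero_le hi
    exact E.prop_of_iso (R.cochainComplexXIso _ j rfl).symm (hR j)
  · exact h0 _ (CochainComplex.isZero_of_isStrictlyGE _ 0 _ (by lia))

end boundedComplexes

section fullProjective

open Opposite

section

variable {A : Type*} [Category* A] {B : Type*} [Category* B] (Φ : Aᵒᵖ ⥤ B)

/-- The objects `X` with projective image under a contravariant functor `Φ` such that `Φ` is full
on morphisms to `X`. They are the analogues of the cofree comodules, whose duals are free. -/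
def fullProjective : ObjectProperty A := fun X =>
  Projective (Φ.obj (op X)) ∧
    ∀ (N : A) (g : Φ.obj (op X) ⟶ Φ.obj (op N)), ∃ f : N ⟶ X, Φ.map f.op = g

/-- The objects isomorphic to the image of an object of `fullProjective Φ`. -/
abbrev fullProjectiveImage : ObjectProperty B := (fullProjective Φ).op.map Φ

instance fullProjective_isClosedUnderIsomorphisms :
    (fullProjective Φ).IsClosedUnderIsomorphisms where
  of_iso {X Y} e hX := by
    refine ⟨Projective.of_iso (Φ.mapIso e.symm.op) hX.1, fun N g => ?_⟩
    obtain ⟨f, hf⟩ := hX.2 N (Φ.map e.inv.op ≫ g)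
    refine ⟨f ≫ e.hom, ?_⟩
    rw [op_comp, Φ.map_comp, hf, ← Φ.map_comp_assoc, ← op_comp, e.inv_hom_id, op_id, Φ.map_id,
      Category.id_comp]

variable {Φ}

lemma hom_ext_of_map_op [Φ.Faithful] {X Y : A} {f g : X ⟶ Y} (h : Φ.map f.op = Φ.map g.op) :
    f = g :=
  Quiver.Hom.op_inj (Φ.map_injective h)

lemma fullProjective.injective [Φ.Faithful] [Φ.PreservesEpimorphisms] {X : A}
    (hX : fullProjective Φ X) : Injective X where
  factors {U V} f i _ := by
    have := hX.1
    obtain ⟨h, hh⟩ := hX.2 V (Projective.factorThru (Φ.map f.op) (Φ.map i.op))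
    refine ⟨h, hom_ext_of_map_op (Φ := Φ) ?_⟩
    rw [op_comp, Φ.map_comp, hh, Projective.factorThru_comp]

lemma projective_of_fullProjectiveImage {Y : B} (hY : fullProjectiveImage Φ Y) : Projective Y := by
  obtain ⟨X, hX, ⟨e⟩⟩ := (ObjectProperty.prop_map_iff _ _ _).1 hY
  exact Projective.of_iso e hX.1

lemma exists_lift_family {ι κ : Type*} (e : ι ≃ κ) {X Y : κ → A}
    (hY : ∀ q, fullProjective Φ (Y q)) (G : ∀ i, Φ.obj (op (Y (e i))) ⟶ Φ.obj (op (X (e i)))) :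
    ∃ s : ∀ q, X q ⟶ Y q, ∀ i, Φ.map (s (e i)).op = G i := by
  choose s hs using fun i => (hY (e i)).2 _ (G i)
  exact ⟨e.piCongrLeft (fun q => X q ⟶ Y q) s, fun i => by
    rw [Equiv.piCongrLeft_apply_apply, hs]⟩

end

variable {A : Type*} [Category* A] [Preadditive A] {B : Type*} [Category* B] [Preadditive B]
  (Φ : Aᵒᵖ ⥤ B) [Φ.Additive]

variable {Φ} in
lemma fullProjective.of_isZero {X : A} (hX : IsZero X) : fullProjective Φ X :=
  have hX' : IsZero (Φ.obj (op X)) := Φ.map_isZero hX.op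
  ⟨⟨fun _ _ _ => ⟨0, hX'.eq_of_src _ _⟩⟩, fun _ _ => ⟨0, hX'.eq_of_src _ _⟩⟩

variable [HasBinaryBiproducts A] [HasBinaryBiproducts B]

/-- An additive contravariant functor commutes with binary biproducts. -/
noncomputable def contraBiprodIso (X Y : A) :
    Φ.obj (op (X ⊞ Y)) ≅ Φ.obj (op X) ⊞ Φ.obj (op Y) where
  hom := biprod.lift (Φ.map biprod.inl.op) (Φ.map biprod.inr.op)
  inv := biprod.desc (Φ.map biprod.fst.op) (Φ.map biprod.snd.op)
  hom_inv_id := by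
    rw [biprod.lift_desc, ← Φ.map_comp, ← Φ.map_comp, ← op_comp, ← op_comp, ← Φ.map_add,
      ← op_add, biprod.total, op_id, Φ.map_id]
  inv_hom_id := by
    ext <;> simp [← Φ.map_comp, ← op_comp]

lemma inl_contraBiprodIso_inv (X Y : A) :
    biprod.inl ≫ (contraBiprodIso Φ X Y).inv = Φ.map biprod.fst.op :=
  biprod.inl_desc _ _

lemma inr_contraBiprodIso_inv (X Y : A) :
    biprod.inr ≫ (contraBiprodIso Φ X Y).inv = Φ.map biprod.snd.op :=
  biprod.inr_desc _ _

variable {Φ}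

lemma fullProjective.biprod {X Y : A} (hX : fullProjective Φ X) (hY : fullProjective Φ Y) :
    fullProjective Φ (X ⊞ Y) := by
  have := hX.1
  have := hY.1
  refine ⟨Projective.of_iso (contraBiprodIso Φ X Y).symm inferInstance, fun N g => ?_⟩
  obtain ⟨f₁, hf₁⟩ := hX.2 N (Φ.map biprod.fst.op ≫ g)
  obtain ⟨f₂, hf₂⟩ := hY.2 N (Φ.map biprod.snd.op ≫ g)
  refine ⟨f₁ ≫ biprod.inl + f₂ ≫ biprod.inr, ?_⟩
  rw [op_add, Φ.map_add, op_comp, op_comp, Φ.map_comp, Φ.map_comp, hf₁, hf₂, ← Φ.map_comp_assoc,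
    ← Φ.map_comp_assoc, ← Preadditive.add_comp, ← Φ.map_add, ← op_comp, ← op_comp, ← op_add,
    biprod.total, op_id, Φ.map_id, Category.id_comp]

lemma fullProjectiveImage_biprod {X Y : B} (hX : fullProjectiveImage Φ X)
    (hY : fullProjectiveImage Φ Y) : fullProjectiveImage Φ (X ⊞ Y) := by
  obtain ⟨X', hX', ⟨e⟩⟩ := (ObjectProperty.prop_map_iff _ _ _).1 hX
  obtain ⟨Y', hY', ⟨e'⟩⟩ := (ObjectProperty.prop_map_iff _ _ _).1 hY
  exact (ObjectProperty.prop_map_iff _ _ _).2 ⟨op (X'.unop ⊞ Y'.unop), hX'.biprod hY',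
    ⟨contraBiprodIso Φ X'.unop Y'.unop ≪≫ biprod.mapIso e e'⟩⟩

end fullProjective

section complexesOfFullProjectives

open Opposite

variable {A : Type*} [Category* A] [Abelian A] {B : Type*} [Category* B] [Abelian B]
  {Φ : Aᵒᵖ ⥤ B} [Φ.Additive]

lemma boundedAboveIn_contraComplex_obj {I : CochainComplex A ℤ}
    (hI : boundedBelowIn (fullProjective Φ) I) :
    boundedAboveIn (fullProjectiveImage Φ) ((contraComplex Φ).obj (op I)) := by
  obtain ⟨⟨a, _⟩, hI⟩ := hI
  refine ⟨⟨-a, (CochainComplex.isStrictlyLE_iff _ _).2 fun i hi => ?_⟩, fun i =>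
    ObjectProperty.prop_map_obj _ _ (hI (-i))⟩
  exact Φ.map_isZero (I.isZero_of_isStrictlyGE a (-i) (by lia)).op

variable [Φ.Faithful]

lemma contraComplex_map_op_surjective {K I : CochainComplex A ℤ}
    (hI : ∀ i, fullProjective Φ (I.X i)) :
    Function.Surjective fun f : K ⟶ I => (contraComplex Φ).map f.op := by
  intro g
  obtain ⟨s, hs⟩ := exists_lift_family (X := K.X) (Equiv.neg ℤ) hI g.f
  replace hs (i : ℤ) : Φ.map (s (-i)).op = g.f i := hs i
  refine ⟨{ f := s, comm' := fun p q _ => ?_ }, HomologicalComplex.Hom.ext (funext hs)⟩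
  obtain ⟨i, rfl⟩ := neg_surjective p
  obtain ⟨j, rfl⟩ := neg_surjective q
  apply hom_ext_of_map_op (Φ := Φ)
  rw [op_comp, op_comp, Φ.map_comp, Φ.map_comp, hs, hs]
  exact (g.comm j i).symm

lemma nonempty_homotopy_of_contraComplex {K I : CochainComplex A ℤ}
    (hI : ∀ i, fullProjective Φ (I.X i)) {f g : K ⟶ I}
    (H : Homotopy ((contraComplex Φ).map f.op) ((contraComplex Φ).map g.op)) :
    Nonempty (Homotopy f g) := by
  obtain ⟨s, hs⟩ := exists_lift_family (X := fun q : ℤ × ℤ => K.X q.1)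
    ((Equiv.neg ℤ).prodCongr (Equiv.neg ℤ)) (fun q => hI q.2) fun i => H.hom i.2 i.1
  replace hs (i j : ℤ) : Φ.map (s (-j, -i)).op = H.hom i j := hs (j, i)
  refine ⟨{ hom := fun p q => s (p, q), zero := fun p q hpq => ?_, comm := fun p => ?_ }⟩
  · obtain ⟨j, rfl⟩ := neg_surjective p
    obtain ⟨i, rfl⟩ := neg_surjective q
    apply hom_ext_of_map_op (Φ := Φ)
    rw [hs, H.zero _ _ fun hij => hpq (by simp only [ComplexShape.up_Rel] at hij ⊢; lia), op_zero,
      Φ.map_zero]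
    rfl
  · obtain ⟨i, rfl⟩ := neg_surjective p
    have hH := H.comm i
    rw [dNext_eq _ (i' := i + 1) (by simp), prevD_eq _ (j' := i - 1) (by simp), ← hs, ← hs] at hH
    apply hom_ext_of_map_op (Φ := Φ)
    rw [dNext_eq _ (i' := -(i - 1)) (by simp; lia), prevD_eq _ (j' := -(i + 1)) (by simp)]
    simp only [op_add, Φ.map_add, op_comp, Φ.map_comp]
    rw [add_comm (Φ.map (s _).op ≫ _)]
    exact hH

lemma exists_contraComplex_obj_iso_of_X_iso {X : ℤ → A} (hX : ∀ p, fullProjective Φ (X p))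
    {K : CochainComplex B ℤ} (ε : ∀ i, Φ.obj (op (X (-i))) ≅ K.X i) :
    ∃ I : CochainComplex A ℤ, (∀ i, fullProjective Φ (I.X i)) ∧
      Nonempty ((contraComplex Φ).obj (op I) ≅ K) := by
  obtain ⟨d, hd⟩ := exists_lift_family (X := fun q : ℤ × ℤ => X q.1)
    ((Equiv.neg ℤ).prodCongr (Equiv.neg ℤ)) (fun q => hX q.2)
    fun i => (ε i.2).hom ≫ K.d i.2 i.1 ≫ (ε i.1).inv
  replace hd (i j : ℤ) : Φ.map (d (-j, -i)).op = (ε i).hom ≫ K.d i j ≫ (ε j).inv := hd (j, i)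
  refine ⟨{ X, d := fun p q => d (p, q), shape := fun p q hpq => ?_
            d_comp_d' := fun p q r _ _ => ?_ }, hX,
    ⟨HomologicalComplex.Hom.isoOfComponents ε fun i j _ => ?_⟩⟩
  · obtain ⟨j, rfl⟩ := neg_surjective p
    obtain ⟨i, rfl⟩ := neg_surjective q
    apply hom_ext_of_map_op (Φ := Φ)
    rw [hd, K.shape _ _ fun hij => hpq (by simp only [ComplexShape.up_Rel] at hij ⊢; lia), op_zero,
      Φ.map_zero, zero_comp, comp_zero]
  · obtain ⟨i, rfl⟩ := neg_surjective p
    obtain ⟨j, rfl⟩ := neg_surjective q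
    obtain ⟨l, rfl⟩ := neg_surjective r
    apply hom_ext_of_map_op (Φ := Φ)
    simp only [op_comp, Φ.map_comp, hd, Category.assoc, Iso.inv_hom_id_assoc, K.d_comp_d_assoc,
      zero_comp, comp_zero, op_zero, Φ.map_zero]
  · rw [contraComplex_obj_d]
    exact ((Iso.eq_comp_inv _).1 ((hd i j).trans (Category.assoc _ _ _).symm)).symm

lemma exists_contraComplex_obj_iso {K : CochainComplex B ℤ}
    (hK : boundedAboveIn (fullProjectiveImage Φ) K) :
    ∃ I, boundedBelowIn (fullProjective Φ) I ∧ Nonempty ((contraComplex Φ).obj (op I) ≅ K) := by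
  obtain ⟨⟨a, _⟩, hK⟩ := hK
  choose X hX e using fun i => (ObjectProperty.prop_map_iff _ _ _).1 (hK i)
  obtain ⟨I, hI, ⟨e⟩⟩ := exists_contraComplex_obj_iso_of_X_iso (X := fun p => (X (-p)).unop)
    (fun p => hX (-p)) fun i => Φ.mapIso (eqToIso (by simp)) ≪≫ (e i).some
  refine ⟨I, ⟨⟨-a, (CochainComplex.isStrictlyGE_iff _ _).2 fun p hp => ?_⟩, hI⟩, ⟨e⟩⟩
  obtain ⟨i, rfl⟩ := neg_surjective p
  have hz : IsZero (Φ.obj (op (I.X (-i)))) := (K.isZero_of_isStrictlyLE a i (by lia)).of_iso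
    ((HomologicalComplex.eval _ _ i).mapIso e)
  exact (IsZero.iff_id_eq_zero _).2 (hom_ext_of_map_op (hz.eq_of_src _ _))

end complexesOfFullProjectives

section contraDerivedCohomology

open Opposite DerivedCategory

variable {A : Type*} [Category* A] [Abelian A] {B : Type*} [Category* B] [Abelian B]

lemma isZero_obj_op_iff (Φ : Aᵒᵖ ⥤ B) [Φ.Additive] [Φ.Faithful] (M : A) :
    IsZero M ↔ IsZero (Φ.obj (op M)) :=
  ⟨fun hM => Φ.map_isZero hM.op, fun hM => (IsZero.iff_id_eq_zero _).2
    (hom_ext_of_map_op (Φ := Φ) (hM.eq_of_src _ _))⟩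

variable [HasDerivedCategory.{v} A] [HasDerivedCategory.{w} B]
  (Φ : Aᵒᵖ ⥤ B) [Φ.Additive] [PreservesFiniteLimits Φ] [PreservesFiniteColimits Φ]

lemma nonempty_contraDerived_singleFunctor_iso {n m : ℤ} (h : n + m = 0) (M : A) :
    Nonempty ((contraDerived Φ).obj (op ((singleFunctor A m).obj M)) ≅
      (singleFunctor B n).obj (Φ.obj (op M))) := by
  let D := (contraDerived Φ).obj (op ((singleFunctor A m).obj M))
  have hD (i : ℤ) (hi : i ≠ n) : IsZero ((homologyFunctor B i).obj D) := by
    obtain ⟨e⟩ := nonempty_homology_contraDerived_iso Φ ((singleFunctor A m).obj M)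
      (add_neg_cancel i)
    refine (Φ.map_isZero (IsZero.op ?_)).of_iso e
    obtain hi | hi := lt_or_gt_of_ne hi
    · exact isZero_of_isLE _ m (-i) (by lia)
    · exact isZero_of_isGE _ m (-i) (by lia)
  have : D.IsGE n := (isGE_iff _ _).2 fun i hi => hD i (by lia)
  have : D.IsLE n := (isLE_iff _ _).2 fun i hi => hD i (by lia)
  obtain ⟨Y, ⟨e⟩⟩ := exists_iso_singleFunctor_obj_of_isGE_of_isLE D n
  obtain ⟨e'⟩ := nonempty_homology_contraDerived_iso Φ ((singleFunctor A m).obj M) h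
  exact ⟨e ≪≫ (singleFunctor B n).mapIso (((singleFunctorCompHomologyFunctorIso B n).app Y).symm ≪≫
    (homologyFunctor B n).mapIso e.symm ≪≫ e' ≪≫
    Φ.mapIso ((singleFunctorCompHomologyFunctorIso A m).app M).symm.op)⟩

section

variable {Φ} {P : ObjectProperty A} {P' : ObjectProperty B} (X : DerivedCategory A) {a b : ℤ}

lemma prop_homology_contraDerived_iff [P'.IsClosedUnderIsomorphisms]
    (hP : ∀ M, P M ↔ P' (Φ.obj (op M))) (h : a + b = 0) :
    P' ((homologyFunctor B a).obj ((contraDerived Φ).obj (op X))) ↔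
      P ((homologyFunctor A b).obj X) := by
  obtain ⟨e⟩ := nonempty_homology_contraDerived_iso Φ X h
  exact (P'.prop_iff_of_iso e).trans (hP _).symm

variable [Φ.Faithful]

lemma isGE_contraDerived_iff (h : a + b = 0) :
    ((contraDerived Φ).obj (op X)).IsGE a ↔ X.IsLE b := by
  have hX (i : ℤ) := prop_homology_contraDerived_iff (P := IsZero) (P' := IsZero) X
    (isZero_obj_op_iff Φ) (add_neg_cancel i)
  rw [isGE_iff, isLE_iff]
  exact ⟨fun H i hi => (neg_neg i) ▸ (hX (-i)).1 (H _ (by lia)),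
    fun H i hi => (hX i).2 (H _ (by lia))⟩

lemma isLE_contraDerived_iff (h : a + b = 0) :
    ((contraDerived Φ).obj (op X)).IsLE a ↔ X.IsGE b := by
  have hX (i : ℤ) := prop_homology_contraDerived_iff (P := IsZero) (P' := IsZero) X
    (isZero_obj_op_iff Φ) (add_neg_cancel i)
  rw [isLE_iff, isGE_iff]
  exact ⟨fun H i hi => (neg_neg i) ▸ (hX (-i)).1 (H _ (by lia)),
    fun H i hi => (hX i).2 (H _ (by lia))⟩

lemma boundedCohomologyIn_contraDerived_iff [P.IsSerreClass] [P'.IsSerreClass]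
    (hP : ∀ M, P M ↔ P' (Φ.obj (op M))) :
    boundedCohomologyIn P' ((contraDerived Φ).obj (op X)) ↔ boundedCohomologyIn P X := by
  constructor
  · rintro ⟨⟨⟨a, ha⟩, ⟨b, hb⟩⟩, hX⟩
    exact ⟨⟨⟨-b, (isLE_contraDerived_iff X (add_neg_cancel b)).1 hb⟩,
      ⟨-a, (isGE_contraDerived_iff X (add_neg_cancel a)).1 ha⟩⟩,
      fun i => (prop_homology_contraDerived_iff X hP (neg_add_cancel i)).1 (hX (-i))⟩
  · rintro ⟨⟨⟨a, ha⟩, ⟨b, hb⟩⟩, hX⟩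
    exact ⟨⟨⟨-b, (isGE_contraDerived_iff X (neg_add_cancel b)).2 hb⟩,
      ⟨-a, (isLE_contraDerived_iff X (neg_add_cancel a)).2 ha⟩⟩,
      fun i => (prop_homology_contraDerived_iff X hP (add_neg_cancel i)).2 (hX (-i))⟩

end

end contraDerivedCohomology

section contraDerivedFullyFaithful

open Opposite DerivedCategory

lemma map_op_bijective_of_iso {T T' : Type*} [Category* T] [Category* T'] (F : Tᵒᵖ ⥤ T')
    {X X' Y Y' : T} (e : X ≅ X') (e' : Y ≅ Y')
    (h : Function.Bijective fun f : X ⟶ Y => F.map f.op) :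
    Function.Bijective fun f : X' ⟶ Y' => F.map f.op := by
  convert (((F.mapIso e'.op).symm.homCongr (F.mapIso e.op).symm).bijective.comp h).comp
    (e.homCongr e').symm.bijective using 1
  ext f
  simp [Iso.homCongr, ← Functor.map_comp, ← op_comp]

variable {A : Type*} [Category* A] [Abelian A] [HasDerivedCategory.{v} A]
  {B : Type*} [Category* B] [Abelian B] [HasDerivedCategory.{w} B]
  {Φ : Aᵒᵖ ⥤ B} [Φ.Additive] [PreservesFiniteLimits Φ] [PreservesFiniteColimits Φ] [Φ.Faithful]

lemma contraDerived_map_Q_bijective (K : CochainComplex A ℤ) {I : CochainComplex A ℤ}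
    (hI : boundedBelowIn (fullProjective Φ) I) :
    Function.Bijective fun f : Q.obj K ⟶ Q.obj I => (contraDerived Φ).map f.op := by
  have := hI.isKInjective fun _ hX => hX.injective
  have := (boundedAboveIn_contraComplex_obj hI).isKProjective
    fun _ hY => projective_of_fullProjectiveImage hY
  constructor
  · intro f g hfg
    obtain ⟨f, rfl⟩ := Q_map_surjective_of_isKInjective K I f
    obtain ⟨g, rfl⟩ := Q_map_surjective_of_isKInjective K I g
    dsimp only at hfg
    rw [contraDerived_map_Q_map, contraDerived_map_Q_map] at hfg
    obtain ⟨H⟩ := nonempty_homotopy_of_isKProjective ((cancel_mono _).1 ((cancel_epi _).1 hfg))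
    obtain ⟨H'⟩ := nonempty_homotopy_of_contraComplex hI.2 H
    exact Q_map_eq_of_homotopy _ H'
  · intro g
    obtain ⟨g', hg'⟩ := Q_map_surjective_of_isKProjective _ _
      ((contraDerivedFactors Φ).inv.app (op I) ≫ g ≫ (contraDerivedFactors Φ).hom.app (op K))
    obtain ⟨f, rfl⟩ := contraComplex_map_op_surjective hI.2 g'
    refine ⟨Q.map f, ?_⟩
    dsimp only at hg' ⊢
    rw [contraDerived_map_Q_map, hg']
    simp

lemma contraDerived_map_bijective (X : DerivedCategory A) {Y : DerivedCategory A}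
    (hY : representedBy (boundedBelowIn (fullProjective Φ)) Y) :
    Function.Bijective fun f : X ⟶ Y => (contraDerived Φ).map f.op := by
  obtain ⟨I, hI, ⟨e⟩⟩ := hY
  exact map_op_bijective_of_iso _ (Q.objObjPreimageIso X) e (contraDerived_map_Q_bijective _ hI)

end contraDerivedFullyFaithful

section contraRestrict

open Opposite

variable {T T' : Type*} [Category* T] [Category* T'] {P : ObjectProperty T}
  {P' : ObjectProperty T'} (F : Tᵒᵖ ⥤ T') (hF : ∀ X, P X → P' (F.obj (op X)))

/-- The restriction of a contravariant functor to full subcategories. -/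
abbrev contraRestrict : P.FullSubcategoryᵒᵖ ⥤ P'.FullSubcategory :=
  P'.lift (P.ι.op ⋙ F) fun X => hF _ X.unop.property

instance contraRestrict_additive [Preadditive T] [Preadditive T'] [F.Additive] :
    (contraRestrict F hF).Additive where
  map_add {_ _ f g} :=
    ObjectProperty.hom_ext _ (F.map_add (f := f.unop.hom.op) (g := g.unop.hom.op))

lemma contraRestrict_isEquivalence
    (hbij : ∀ X Y, P Y → Function.Bijective fun f : X ⟶ Y => F.map f.op)
    (hess : ∀ Y, P' Y → ∃ X, P X ∧ Nonempty (F.obj (op X) ≅ Y)) :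
    (contraRestrict F hF).IsEquivalence where
  faithful := ⟨fun {X _} f g hfg => Quiver.Hom.unop_inj <| ObjectProperty.hom_ext _ <|
    (hbij _ _ X.unop.property).injective (congrArg (·.hom) hfg)⟩
  full := ⟨fun {X _} g => by
    obtain ⟨f, hf⟩ := (hbij _ _ X.unop.property).surjective g.hom
    exact ⟨(ObjectProperty.homMk f).op, ObjectProperty.hom_ext _ hf⟩⟩
  essSurj := ⟨fun Y => by
    obtain ⟨X, hX, ⟨e⟩⟩ := hess _ Y.property
    exact ⟨op ⟨X, hX⟩, ⟨ObjectProperty.isoMk _ e⟩⟩⟩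

section

variable [HasShift T ℤ] [HasShift T' ℤ] [P.IsStableUnderShift ℤ] [P'.IsStableUnderShift ℤ]

/-- The restriction of a contravariant functor changing the sign of a shift also changes the sign of
this shift. -/
noncomputable def contraRestrictShiftIso {n m : ℤ}
    (e : (shiftFunctor T n).op ⋙ F ≅ F ⋙ shiftFunctor T' m) :
    (shiftFunctor P.FullSubcategory n).op ⋙ contraRestrict F hF ≅
      contraRestrict F hF ⋙ shiftFunctor P'.FullSubcategory m :=
  (P'.fullyFaithfulι.whiskeringRight _).preimageIso
    (Functor.isoWhiskerRight (NatIso.op (P.ι.commShiftIso n).symm) F ≪≫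
      Functor.isoWhiskerLeft P.ι.op e ≪≫
      Functor.isoWhiskerLeft (contraRestrict F hF) (P'.ι.commShiftIso m).symm)

end

variable {k : Type*} [Semiring k] [Preadditive T] [Preadditive T'] [Linear k T] [Linear k T']

instance contraRestrict_linear [F.Linear k] : (contraRestrict F hF).Linear k where
  map_smul f a := ObjectProperty.hom_ext _ (F.map_smul a f.unop.hom.op)

lemma linear_of_comp_faithful {T'' : Type*} [Category* T''] [Preadditive T''] [Linear k T'']
    (G : T ⥤ T') (H : T' ⥤ T'') [H.Faithful] [H.Linear k] [(G ⋙ H).Linear k] : G.Linear k where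
  map_smul f a := H.map_injective <| by
    rw [H.map_smul]
    exact (G ⋙ H).map_smul a f

instance shiftFunctor_fullSubcategory_linear [HasShift T ℤ] [P.IsStableUnderShift ℤ] (n : ℤ)
    [(shiftFunctor T n).Linear k] : (shiftFunctor P.FullSubcategory n).Linear k :=
  have : (shiftFunctor P.FullSubcategory n ⋙ P.ι).Linear k :=
    Functor.linear_of_iso k (P.ι.commShiftIso n).symm
  linear_of_comp_faithful _ P.ι

end contraRestrict

section derivedDuality

open Opposite DerivedCategory

variable {A : Type*} [Category* A] [Abelian A] {B : Type*} [Category* B] [Abelian B]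

/-- The hypotheses under which an exact faithful contravariant functor `Φ` induces a contravariant
equivalence between the bounded derived categories of `A` and `B` with cohomology in `P` and `P'`:
`Φ` is essentially surjective from `P` to `P'`, and the objects satisfying `P` have resolutions by
objects that `Φ` sends fully to projective objects. `Φ` need not be full on `P`. -/
structure IsDerivedDuality (Φ : Aᵒᵖ ⥤ B) (P : ObjectProperty A) (P' : ObjectProperty B) : Prop where
  resolution : ∀ M, P M → ∃ R : InjectiveResolution M, ∀ n, fullProjective Φ (R.cocomplex.X n)
  prop_iff : ∀ M, P M ↔ P' (Φ.obj (op M))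
  essSurj : ∀ V, P' V → ∃ M, Nonempty (Φ.obj (op M) ≅ V)

/-- A shifted injective resolution represents a single object in the derived category. -/
noncomputable def injectiveResolutionShiftIso [HasDerivedCategory.{v} A] {M : A}
    (R : InjectiveResolution M) {n m : ℤ} (h : n + m = 0) :
    Q.obj (R.cochainComplex⟦n⟧) ≅ (singleFunctor A m).obj M :=
  (Q.commShiftIso n).app _ ≪≫ (shiftFunctor _ n).mapIso (asIso (Q.map R.ι')).symm ≪≫
    ((singleFunctors A).shiftIso n m 0 h).app M

namespace IsDerivedDuality

variable [HasDerivedCategory.{v} A] {Φ : Aᵒᵖ ⥤ B} [Φ.Additive]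
  {P : ObjectProperty A} [P.IsSerreClass] {P' : ObjectProperty B} (h : IsDerivedDuality Φ P P')
include h

omit [P.IsSerreClass] in
lemma exists_boundedBelowIn_iso_singleFunctor {n m : ℤ} (hnm : n + m = 0) {M : A} (hM : P M) :
    ∃ I, boundedBelowIn (fullProjective Φ) I ∧ Nonempty (Q.obj I ≅ (singleFunctor A m).obj M) := by
  obtain ⟨R, hR⟩ := h.resolution M hM
  exact ⟨_, (boundedBelowIn_cochainComplex (fun _ => .of_isZero) R hR).shift n,
    ⟨injectiveResolutionShiftIso R hnm⟩⟩

variable [PreservesFiniteLimits Φ] [PreservesFiniteColimits Φ] [Φ.Faithful]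

lemma boundedCohomologyIn_le_representedBy :
    boundedCohomologyIn P ≤ representedBy (boundedBelowIn (fullProjective Φ)) := by
  have : (representedBy (boundedBelowIn (fullProjective Φ))).IsTriangulatedClosed₂ :=
    representedBy_isTriangulatedClosed₂ _ (fun K n hK => hK.shift n)
      (fun f hK hL => hK.mappingCone (fun _ _ hX hY => hX.biprod hY) f hL) fun {K L} _ hL => by
        have := hL.isKInjective fun _ hX => hX.injective
        exact Q_map_surjective_of_isKInjective K L
  exact boundedCohomologyIn_le _ _ fun n M hM =>
    h.exists_boundedBelowIn_iso_singleFunctor (neg_add_cancel n) hM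

variable [HasDerivedCategory.{w} B] [P'.IsSerreClass]

omit [Φ.Faithful] [P.IsSerreClass] in
lemma boundedCohomologyIn_le_representedBy_image :
    boundedCohomologyIn P' ≤ representedBy (boundedAboveIn (fullProjectiveImage Φ)) := by
  have : (representedBy (boundedAboveIn (fullProjectiveImage Φ))).IsTriangulatedClosed₂ :=
    representedBy_isTriangulatedClosed₂ _ (fun K n hK => hK.shift n)
      (fun f hK hL => hK.mappingCone (fun _ _ => fullProjectiveImage_biprod) f hL) fun {K L} hK _ =>
        have := hK.isKProjective fun _ hX => projective_of_fullProjectiveImage hX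
        Q_map_surjective_of_isKProjective K L
  refine boundedCohomologyIn_le _ _ fun n V hV => ?_
  obtain ⟨M, ⟨e⟩⟩ := h.essSurj V hV
  have hM : P M := (h.prop_iff M).2 (P'.prop_of_iso e.symm hV)
  obtain ⟨I, hI, ⟨e'⟩⟩ := h.exists_boundedBelowIn_iso_singleFunctor (add_neg_cancel n) hM
  obtain ⟨e''⟩ := nonempty_contraDerived_singleFunctor_iso Φ (add_neg_cancel n) M
  exact ⟨_, boundedAboveIn_contraComplex_obj hI,
    ⟨(contraDerivedFactors Φ).symm.app (op I) ≪≫ (contraDerived Φ).mapIso e'.symm.op ≪≫ e'' ≪≫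
      (singleFunctor B n).mapIso e⟩⟩

omit [P.IsSerreClass] in
lemma exists_contraDerived_obj_iso {Y : DerivedCategory B} (hY : boundedCohomologyIn P' Y) :
    ∃ X, Nonempty ((contraDerived Φ).obj (op X) ≅ Y) := by
  obtain ⟨K, hK, ⟨e⟩⟩ := h.boundedCohomologyIn_le_representedBy_image _ hY
  obtain ⟨I, -, ⟨e'⟩⟩ := exists_contraComplex_obj_iso hK
  exact ⟨Q.obj I, ⟨(contraDerivedFactors Φ).app (op I) ≪≫ Q.mapIso e' ≪≫ e⟩⟩

theorem isCalabiYauCategory_iff {k : Type*} [Field k] [Linear k A] [Linear k B] [Φ.Linear k]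
    (n : ℤ) :
    IsCalabiYauCategory k (boundedCohomologyIn P).FullSubcategory n ↔
      IsCalabiYauCategory k (boundedCohomologyIn P').FullSubcategory n := by
  have hΦ (X : DerivedCategory A) := boundedCohomologyIn_contraDerived_iff X h.prop_iff
  have : (boundedCohomologyIn P').IsClosedUnderIsomorphisms := by
    unfold boundedCohomologyIn
    infer_instance
  have : (contraRestrict (contraDerived Φ) fun X => (hΦ X).2).IsEquivalence := by
    refine contraRestrict_isEquivalence _ _ (fun X Y hY => contraDerived_map_bijective X
      (h.boundedCohomologyIn_le_representedBy Y hY)) fun Y hY => ?_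
    obtain ⟨X, ⟨e⟩⟩ := h.exists_contraDerived_obj_iso hY
    exact ⟨X, (hΦ X).1 ((boundedCohomologyIn P').prop_of_iso e.symm hY), ⟨e⟩⟩
  exact IsCalabiYauCategory.iff_of_contravariant
    (contraRestrict (contraDerived Φ) fun X => (hΦ X).2)
    (fun _ _ hmn => contraRestrictShiftIso _ _ (contraDerivedShiftIso Φ hmn)) n

end IsDerivedDuality

end derivedDuality

section linearForms

variable {R : Type*} [CommSemiring R] {C : Type*} [AddCommMonoid C] [Module R C]
  {W : Type*} [AddCommMonoid W] [Module R W]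

lemma apply_rid_lTensor (f : C →ₗ[R] R) (φ : W →ₗ[R] R) (t : C ⊗[R] W) :
    f (TensorProduct.rid R C (φ.lTensor C t)) =
      LinearMap.mul' R R (TensorProduct.map f φ t) := by
  induction t with
  | zero => simp
  | add a b ha hb => simp only [map_add, ha, hb]
  | tmul c m => simp [mul_comm]

variable [Coalgebra R C]

lemma mul'_map_convMul (f g : WithConv (C →ₗ[R] R)) (φ : W →ₗ[R] R) (t : C ⊗[R] W) :
    LinearMap.mul' R R (TensorProduct.map (f * g).ofConv φ t) =
      LinearMap.mul' R R (TensorProduct.map f.ofConv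
        (LinearMap.mul' R R ∘ₗ TensorProduct.map g.ofConv φ)
          (TensorProduct.assoc R C C W (Coalgebra.comul.rTensor W t))) := by
  induction t with
  | zero => simp
  | add a b ha hb => simp only [map_add, ha, hb]
  | tmul c m =>
    rw [LinearMap.rTensor_tmul, TensorProduct.map_tmul, LinearMap.mul'_apply,
      LinearMap.convMul_apply]
    induction (Coalgebra.comul (R := R) c) with
    | zero => simp
    | add a b ha hb => simp only [TensorProduct.add_tmul, map_add, ha, hb, add_mul]
    | tmul a b => simp [mul_assoc]

lemma mul'_map_convOne (φ : W →ₗ[R] R) (t : C ⊗[R] W) :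
    LinearMap.mul' R R (TensorProduct.map (1 : WithConv (C →ₗ[R] R)).ofConv φ t) =
      φ (TensorProduct.lid R W (Coalgebra.counit.rTensor W t)) := by
  induction t with
  | zero => simp
  | add a b ha hb => simp only [map_add, ha, hb]
  | tmul c m => simp

lemma comul_rid_lTensor (φ : W →ₗ[R] R) (t : C ⊗[R] W) :
    Coalgebra.comul (TensorProduct.rid R C (φ.lTensor C t)) =
      ((TensorProduct.rid R C).toLinearMap ∘ₗ φ.lTensor C).lTensor C
        (TensorProduct.assoc R C C W (Coalgebra.comul.rTensor W t)) := by
  induction t with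
  | zero => simp
  | add a b ha hb => simp only [map_add, ha, hb]
  | tmul c m =>
    simp only [LinearMap.lTensor_tmul, TensorProduct.rid_tmul, map_smul, LinearMap.rTensor_tmul]
    induction (Coalgebra.comul (R := R) c) with
    | zero => simp
    | add a b ha hb => simp only [TensorProduct.add_tmul, map_add, ha, hb, smul_add]
    | tmul a b => simp

end linearForms

namespace LeftComod

open Opposite

variable {k : Type u} [Field k] {C : Type u} [AddCommGroup C] [Module k C] [Coalgebra k C]

lemma function_exact {S : ShortComplex (LeftComod k C)} (hS : S.Exact) :
    Function.Exact (lin S.f) (lin S.g) := by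
  refine fun x => ⟨fun hx => ?_, ?_⟩
  · have := S.exact_iff_epi_kernel_lift.1 hS
    obtain ⟨z, hz⟩ := surjective_of_epi (kernel.lift S.g S.f S.zero)
      (lin (kernel.lift S.g (kerι S.g) (kerι_comp S.g)) ⟨x, hx⟩)
    have hf := LinearMap.congr_fun (congrArg lin (kernel.lift_ι S.g S.f S.zero)) z
    have hker := LinearMap.congr_fun
      (congrArg lin (kernel.lift_ι S.g (kerι S.g) (kerι_comp S.g))) ⟨x, hx⟩
    exact ⟨z, hf.symm.trans ((congrArg (lin (kernel.ι S.g)) hz).trans hker)⟩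
  · rintro ⟨y, rfl⟩
    exact LinearMap.congr_fun (congrArg lin S.zero) y

/-- The dual space of a left comodule, as a type of its own because it carries two module
structures, over the field and over the dual algebra. -/
def Dual (M : LeftComod k C) : Type u := Module.Dual k M.carrier

namespace Dual

variable {M : LeftComod k C}

instance : AddCommGroup M.Dual := inferInstanceAs (AddCommGroup (Module.Dual k M.carrier))

instance : Module k M.Dual := inferInstanceAs (Module k (Module.Dual k M.carrier))

/-- The linear form underlying an element of the dual space. -/
def form (φ : M.Dual) : M.carrier →ₗ[k] k := φ

/-- The action of the dual algebra on the dual space of a comodule,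
`(f • φ) m = ∑ f m₋₁ * φ m₀`. -/
instance : SMul (Coalgebra.DualAlgebra k C) M.Dual where
  smul f φ := LinearMap.mul' k k ∘ₗ TensorProduct.map f.ofConv φ.form ∘ₗ M.coact

instance : Module (Coalgebra.DualAlgebra k C) M.Dual where
  one_smul φ := LinearMap.ext fun m => (mul'_map_convOne φ.form _).trans
    (congrArg φ.form (LinearMap.congr_fun M.counit_coact m))
  mul_smul f g φ := LinearMap.ext fun m => by
    refine (mul'_map_convMul f g φ.form _).trans ?_
    refine (congrArg (fun t => LinearMap.mul' k k (TensorProduct.map f.ofConv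
      (LinearMap.mul' k k ∘ₗ TensorProduct.map g.ofConv φ.form) t))
        (LinearMap.congr_fun M.coassoc m)).trans ?_
    exact congrArg (LinearMap.mul' k k)
      (LinearMap.congr_fun (LinearMap.map_comp_lTensor _ _ _ _) _)
  smul_zero f := by
    change LinearMap.mul' k k ∘ₗ TensorProduct.map f.ofConv 0 ∘ₗ M.coact = 0
    rw [TensorProduct.map_zero_right, LinearMap.zero_comp, LinearMap.comp_zero]
  smul_add f φ ψ := by
    change LinearMap.mul' k k ∘ₗ TensorProduct.map f.ofConv (φ.form + ψ.form) ∘ₗ M.coact = _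
    rw [TensorProduct.map_add_right, LinearMap.add_comp, LinearMap.comp_add]
    rfl
  add_smul f g φ := by
    change LinearMap.mul' k k ∘ₗ TensorProduct.map (f.ofConv + g.ofConv) φ.form ∘ₗ M.coact = _
    rw [TensorProduct.map_add_left, LinearMap.add_comp, LinearMap.comp_add]
    rfl
  zero_smul φ := by
    change LinearMap.mul' k k ∘ₗ TensorProduct.map 0 φ.form ∘ₗ M.coact = 0
    rw [TensorProduct.map_zero_left, LinearMap.zero_comp, LinearMap.comp_zero]

instance : IsScalarTower k (Coalgebra.DualAlgebra k C) M.Dual where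
  smul_assoc a f φ := by
    change LinearMap.mul' k k ∘ₗ TensorProduct.map (a • f.ofConv) φ.form ∘ₗ M.coact = _
    rw [TensorProduct.map_smul_left, LinearMap.smul_comp, LinearMap.comp_smul]
    rfl

/-- The transpose of a morphism of comodules. -/
noncomputable def map {M N : LeftComod k C} (f : M ⟶ N) :
    N.Dual →ₗ[Coalgebra.DualAlgebra k C] M.Dual where
  toFun φ := φ.form ∘ₗ lin f
  map_add' _ _ := rfl
  map_smul' g φ := by
    change (LinearMap.mul' k k ∘ₗ TensorProduct.map g.ofConv φ.form ∘ₗ N.coact) ∘ₗ lin f =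
      LinearMap.mul' k k ∘ₗ TensorProduct.map g.ofConv (φ.form ∘ₗ lin f) ∘ₗ M.coact
    rw [LinearMap.comp_assoc, LinearMap.comp_assoc, lin_comm, ← LinearMap.map_comp_lTensor,
      LinearMap.comp_assoc]

lemma mem_range_map_iff {M N : LeftComod k C} {f : M ⟶ N} {φ : M.Dual} :
    φ ∈ LinearMap.range (map f) ↔ φ.form ∈ (LinearMap.ker (lin f)).dualAnnihilator := by
  rw [← LinearMap.range_dualMap_eq_dualAnnihilator_ker]
  rfl

lemma range_map_le_range_map_iff {M N N' : LeftComod k C} {f : M ⟶ N} {g : M ⟶ N'} :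
    LinearMap.range (map f) ≤ LinearMap.range (map g) ↔
      LinearMap.ker (lin g) ≤ LinearMap.ker (lin f) := by
  rw [← Subspace.dualAnnihilator_le_dualAnnihilator_iff]
  exact forall_congr' fun φ => imp_congr mem_range_map_iff mem_range_map_iff

lemma range_map_biprod_lift {M X Y : LeftComod k C} (f : M ⟶ X) (g : M ⟶ Y) :
    LinearMap.range (map (biprod.lift f g)) =
      LinearMap.range (map f) ⊔ LinearMap.range (map g) := by
  refine le_antisymm ?_ (sup_le ?_ ?_)
  · rintro _ ⟨ψ, rfl⟩
    rw [biprod.lift_eq]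
    exact Submodule.mem_sup.2 ⟨_, ⟨map (biprod.inl : X ⟶ X ⊞ Y) ψ, rfl⟩, _,
      ⟨map (biprod.inr : Y ⟶ X ⊞ Y) ψ, rfl⟩,
      (LinearMap.comp_add (lin (f ≫ biprod.inl)) (lin (g ≫ biprod.inr)) ψ.form).symm⟩
  · rw [range_map_le_range_map_iff]
    intro x hx
    rw [LinearMap.mem_ker, ← biprod.lift_fst f g, lin_comp, LinearMap.comp_apply, hx, map_zero]
  · rw [range_map_le_range_map_iff]
    intro x hx
    rw [LinearMap.mem_ker, ← biprod.lift_snd f g, lin_comp, LinearMap.comp_apply, hx, map_zero]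

end Dual

section dualFunctor

variable (k C) in
/-- The duality functor from left comodules to left modules over the dual algebra. -/
noncomputable def dualFunctor : (LeftComod k C)ᵒᵖ ⥤ ModuleCat.{u} (Coalgebra.DualAlgebra k C) where
  obj M := ModuleCat.of _ M.unop.Dual
  map f := ModuleCat.ofHom (Dual.map f.unop)
  map_id _ := rfl
  map_comp _ _ := rfl

instance : (dualFunctor k C).Additive where
  map_add {_ _ f g} := by
    ext φ
    exact LinearMap.comp_add (lin f.unop) (lin g.unop) (Dual.form φ)

instance : (dualFunctor k C).Linear k where
  map_smul f a := by
    ext φ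
    exact (LinearMap.comp_smul (Dual.form φ) a (lin f.unop)).trans
      (algebraMap_smul (Coalgebra.DualAlgebra k C) a (Dual.map f.unop φ)).symm

instance : (dualFunctor k C).Faithful where
  map_injective {M N f g} h := by
    refine Quiver.Hom.unop_inj (hom_ext (LinearMap.ext fun x => ?_))
    rw [← sub_eq_zero, ← Module.forall_dual_apply_eq_zero_iff k]
    intro φ
    rw [map_sub, sub_eq_zero]
    exact LinearMap.congr_fun
      (congrArg Dual.form (LinearMap.congr_fun (congrArg ModuleCat.Hom.hom h) φ)) x

lemma dualFunctor_map_exact (S : ShortComplex (LeftComod k C)ᵒᵖ) (hS : S.Exact) :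
    (S.map (dualFunctor k C)).Exact := by
  rw [ShortComplex.moduleCat_exact_iff]
  intro φ hφ
  have hex : Function.Exact (lin S.g.unop) (lin S.f.unop) := function_exact hS.unop
  refine Dual.mem_range_map_iff.2 ((Submodule.mem_dualAnnihilator _).2 fun x hx => ?_)
  obtain ⟨y, rfl⟩ := (hex x).1 hx
  exact LinearMap.congr_fun (congrArg Dual.form hφ) y

lemma preservesFiniteLimits_and_colimits_dualFunctor :
    PreservesFiniteLimits (dualFunctor k C) ∧ PreservesFiniteColimits (dualFunctor k C) :=
  ((dualFunctor k C).exact_tfae.out 1 3).1 dualFunctor_map_exact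

instance : PreservesFiniteLimits (dualFunctor k C) :=
  preservesFiniteLimits_and_colimits_dualFunctor.1

instance : PreservesFiniteColimits (dualFunctor k C) :=
  preservesFiniteLimits_and_colimits_dualFunctor.2

lemma finiteDimensional_iff (M : LeftComod k C) : finiteDimensional k C M ↔
    ModuleCat.finiteDimensional k (Coalgebra.DualAlgebra k C)
      ((dualFunctor k C).obj (op M)) := by
  let e : Module.Dual k M.carrier ≃ₗ[k] (ModuleCat.restrictScalars
      (algebraMap k (Coalgebra.DualAlgebra k C))).obj ((dualFunctor k C).obj (op M)) :=
    { AddEquiv.refl M.Dual with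
      map_smul' := fun a φ => (algebraMap_smul (Coalgebra.DualAlgebra k C) a
        (show M.Dual from φ)).symm }
  exact (Module.finite_dual_iff k).symm.trans (Module.Finite.equiv_iff e)

end dualFunctor

section regular

variable (k C) in
/-- The regular left comodule. -/
def regular : LeftComod k C where
  carrier := C
  coact := Coalgebra.comul
  coassoc := Coalgebra.coassoc
  counit_coact := by
    rw [Coalgebra.rTensor_counit_comp_comul]
    ext
    simp

variable {M : LeftComod k C}

lemma comul_comp_rid_comp_lTensor_comp_coact (φ : M.carrier →ₗ[k] k) :
    Coalgebra.comul ∘ₗ ((TensorProduct.rid k C).toLinearMap ∘ₗ φ.lTensor C ∘ₗ M.coact) =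
      ((TensorProduct.rid k C).toLinearMap ∘ₗ φ.lTensor C ∘ₗ M.coact).lTensor C ∘ₗ M.coact := by
  refine LinearMap.ext fun m => (comul_rid_lTensor φ (M.coact m)).trans ?_
  have h := LinearMap.congr_fun M.coassoc m
  simp only [LinearMap.comp_apply, LinearEquiv.coe_coe] at h
  rw [h, ← LinearMap.comp_assoc, LinearMap.lTensor_comp C _ M.coact]
  rfl

/-- The morphism to the regular comodule given by a linear form, `m ↦ ∑ φ m₀ • m₋₁`. -/
noncomputable def toRegular (φ : M.Dual) : M ⟶ regular k C :=
  mkHom (N := regular k C)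
    ((TensorProduct.rid k C).toLinearMap ∘ₗ φ.form.lTensor C ∘ₗ M.coact)
    (comul_comp_rid_comp_lTensor_comp_coact φ.form)

variable (k C) in
/-- The dual of the regular comodule is the regular module over the dual algebra. -/
noncomputable def dualRegularEquiv :
    Coalgebra.DualAlgebra k C ≃ₗ[Coalgebra.DualAlgebra k C] (regular k C).Dual where
  toFun f := f.ofConv
  invFun φ := WithConv.toConv φ.form
  map_add' _ _ := rfl
  map_smul' _ _ := rfl
  left_inv _ := rfl
  right_inv _ := rfl

lemma map_toRegular (φ : M.Dual) (f : Coalgebra.DualAlgebra k C) :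
    Dual.map (toRegular φ) (dualRegularEquiv k C f) = f • φ :=
  LinearMap.ext fun m => apply_rid_lTensor f.ofConv φ.form (M.coact m)

lemma range_map_toRegular (φ : M.Dual) :
    LinearMap.range (Dual.map (toRegular φ)) =
      Submodule.span (Coalgebra.DualAlgebra k C) {φ} := by
  ext ψ
  rw [Submodule.mem_span_singleton, LinearMap.mem_range, (dualRegularEquiv k C).surjective.exists]
  simp only [map_toRegular]

lemma fullProjective_regular : fullProjective (dualFunctor k C) (regular k C) := by
  refine ⟨?_, fun N g => ⟨toRegular (g.hom (dualRegularEquiv k C 1)), ?_⟩⟩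
  · rw [← IsProjective.iff_projective]
    exact Module.Projective.of_equiv (dualRegularEquiv k C)
  · ext ψ
    obtain ⟨f, rfl⟩ := (dualRegularEquiv k C).surjective ψ
    refine (map_toRegular _ f).trans ?_
    refine (g.hom.map_smul f (dualRegularEquiv k C 1)).symm.trans (congrArg g.hom ?_)
    exact ((dualRegularEquiv k C).map_smul f 1).symm.trans
      (congrArg (dualRegularEquiv k C) (mul_one f))

end regular

section finiteCofree

variable (k C) in
/-- The comodules whose dual is a finitely generated module. -/
def finiteDual : ObjectProperty (LeftComod k C) :=
  fun M => Module.Finite (Coalgebra.DualAlgebra k C) ((dualFunctor k C).obj (op M))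

lemma finiteDual_of_finiteDimensional {M : LeftComod k C} (hM : finiteDimensional k C M) :
    finiteDual k C M := by
  have : Module.Finite k M.carrier := hM
  have : Module.Finite k M.Dual := inferInstanceAs (Module.Finite k (Module.Dual k M.carrier))
  exact Module.Finite.of_restrictScalars_finite k (Coalgebra.DualAlgebra k C) M.Dual

variable (k C) in
/-- The comodules that play the part of the finite powers of the regular comodule: the dual is
finitely generated and projective, and all morphisms from it to duals are transposes. -/
def finiteCofree : ObjectProperty (LeftComod k C) :=
  fullProjective (dualFunctor k C) ⊓ finiteDual k C

lemma finiteCofree_regular : finiteCofree k C (regular k C) :=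
  ⟨fullProjective_regular, Module.Finite.equiv (dualRegularEquiv k C)⟩

lemma finiteCofree.biprod {X Y : LeftComod k C} (hX : finiteCofree k C X)
    (hY : finiteCofree k C Y) : finiteCofree k C (X ⊞ Y) := by
  have : Module.Finite (Coalgebra.DualAlgebra k C) ((dualFunctor k C).obj (op X)) := hX.2
  have : Module.Finite (Coalgebra.DualAlgebra k C) ((dualFunctor k C).obj (op Y)) := hY.2
  exact ⟨hX.1.biprod hY.1, Module.Finite.equiv (contraBiprodIso (dualFunctor k C) X Y ≪≫
    ModuleCat.biprodIsoProd _ _).symm.toLinearEquiv⟩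

lemma exists_range_map_eq {M : LeftComod k C}
    {N : Submodule (Coalgebra.DualAlgebra k C) M.Dual} (hN : N.FG) :
    ∃ (X : LeftComod k C) (f : M ⟶ X), finiteCofree k C X ∧ LinearMap.range (Dual.map f) = N := by
  induction N, hN using Submodule.fg_induction with
  | singleton φ => exact ⟨_, toRegular φ, finiteCofree_regular, range_map_toRegular φ⟩
  | sup _ _ _ _ h₁ h₂ =>
    obtain ⟨X, f, hX, rfl⟩ := h₁
    obtain ⟨Y, g, hY, rfl⟩ := h₂
    exact ⟨X ⊞ Y, biprod.lift f g, hX.biprod hY, Dual.range_map_biprod_lift f g⟩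

/-- A finitely generated submodule of the dual is the annihilator of the kernel of a morphism, so
finitely generated submodules embed into subcomodules with the order reversed. -/
lemma isNoetherian_dual {M : LeftComod k C} (hM : WellFoundedLT {V : Submodule k M.carrier //
    ∀ m ∈ V, M.coact m ∈ LinearMap.range (V.subtype.lTensor C)}) :
    IsNoetherian (Coalgebra.DualAlgebra k C) M.Dual := by
  choose X f _ hf using fun N : {N : Submodule (Coalgebra.DualAlgebra k C) M.Dual // N.FG} =>
    exists_range_map_eq N.2
  have hle {N N' : {N : Submodule (Coalgebra.DualAlgebra k C) M.Dual // N.FG}} :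
      LinearMap.ker (lin (f N')) ≤ LinearMap.ker (lin (f N)) ↔ N ≤ N' := by
    rw [← Dual.range_map_le_range_map_iff, hf, hf, Subtype.coe_le_coe]
  let V (N : {N : Submodule (Coalgebra.DualAlgebra k C) M.Dual // N.FG}) :
      {V : Submodule k M.carrier // ∀ m ∈ V, M.coact m ∈ LinearMap.range (V.subtype.lTensor C)} :=
    ⟨LinearMap.ker (lin (f N)), fun m hm => coact_mem_range_of_mem_ker (f N) ⟨m, hm⟩⟩
  have hV : StrictAnti V := fun _ _ h =>
    lt_of_le_not_ge (hle.2 h.le) fun h' => h.not_ge (hle.1 h')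
  exact isNoetherian_iff_fg_wellFounded.2 hV.wellFoundedGT

lemma isNoetherianRing_dualAlgebra (hC : WellFoundedLT {V : Submodule k C //
    ∀ c ∈ V, Coalgebra.comul (R := k) c ∈ LinearMap.range (V.subtype.lTensor C)}) :
    IsNoetherianRing (Coalgebra.DualAlgebra k C) :=
  have := isNoetherian_dual (M := regular k C) hC
  isNoetherian_of_linearEquiv (dualRegularEquiv k C).symm

variable {V : ModuleCat.{u} (Coalgebra.DualAlgebra k C)}

lemma exists_range_eq_span_singleton (v : V) :
    ∃ (X : LeftComod k C) (p : (dualFunctor k C).obj (op X) ⟶ V), finiteCofree k C X ∧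
      LinearMap.range p.hom = Submodule.span (Coalgebra.DualAlgebra k C) {v} := by
  refine ⟨_, ModuleCat.ofHom (LinearMap.toSpanSingleton (Coalgebra.DualAlgebra k C) V v ∘ₗ
    (dualRegularEquiv k C).symm.toLinearMap), finiteCofree_regular, ?_⟩
  exact (LinearEquiv.range_comp _ _).trans (LinearMap.range_toSpanSingleton v)

lemma range_sup_range_le_range_biprod_desc {X Y : LeftComod k C}
    (p : (dualFunctor k C).obj (op X) ⟶ V) (q : (dualFunctor k C).obj (op Y) ⟶ V) :
    LinearMap.range p.hom ⊔ LinearMap.range q.hom ≤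
      LinearMap.range ((contraBiprodIso (dualFunctor k C) X Y).hom ≫ biprod.desc p q).hom := by
  have hp : (dualFunctor k C).map biprod.fst.op ≫
      (contraBiprodIso (dualFunctor k C) X Y).hom ≫ biprod.desc p q = p := by
    rw [← inl_contraBiprodIso_inv, Category.assoc, Iso.inv_hom_id_assoc, biprod.inl_desc]
  have hq : (dualFunctor k C).map biprod.snd.op ≫
      (contraBiprodIso (dualFunctor k C) X Y).hom ≫ biprod.desc p q = q := by
    rw [← inr_contraBiprodIso_inv, Category.assoc, Iso.inv_hom_id_assoc, biprod.inr_desc]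
  refine sup_le ?_ ?_
  · conv_lhs => rw [← hp]
    exact LinearMap.range_comp_le_range _ _
  · conv_lhs => rw [← hq]
    exact LinearMap.range_comp_le_range _ _

lemma exists_le_range {N : Submodule (Coalgebra.DualAlgebra k C) V} (hN : N.FG) :
    ∃ (X : LeftComod k C) (p : (dualFunctor k C).obj (op X) ⟶ V), finiteCofree k C X ∧
      N ≤ LinearMap.range p.hom := by
  induction N, hN using Submodule.fg_induction with
  | singleton v =>
    obtain ⟨X, p, hX, hp⟩ := exists_range_eq_span_singleton v
    exact ⟨X, p, hX, hp.ge⟩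
  | sup _ _ _ _ h₁ h₂ =>
    obtain ⟨X, p, hX, hp⟩ := h₁
    obtain ⟨Y, q, hY, hq⟩ := h₂
    exact ⟨X ⊞ Y, _, hX.biprod hY,
      (sup_le_sup hp hq).trans (range_sup_range_le_range_biprod_desc p q)⟩

variable (V) in
lemma exists_epi [Module.Finite (Coalgebra.DualAlgebra k C) V] :
    ∃ (X : LeftComod k C) (p : (dualFunctor k C).obj (op X) ⟶ V), finiteCofree k C X ∧ Epi p := by
  obtain ⟨X, p, hX, hp⟩ := exists_le_range (V := V) Module.Finite.fg_top
  exact ⟨X, p, hX, (ModuleCat.epi_iff_range_eq_top p).2 (top_le_iff.1 hp)⟩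

lemma finite_of_finiteDimensional
    (hV : ModuleCat.finiteDimensional k (Coalgebra.DualAlgebra k C) V) :
    Module.Finite (Coalgebra.DualAlgebra k C) V := by
  let _ := ModuleCat.moduleOfAlgebraModule (k := k) V
  have := ModuleCat.isScalarTower_of_algebra_moduleCat (k := k) V
  have : Module.Finite k V := hV
  exact Module.Finite.of_restrictScalars_finite k (Coalgebra.DualAlgebra k C) V

end finiteCofree

section noetherian

variable [IsNoetherianRing (Coalgebra.DualAlgebra k C)]

lemma exists_embedding (M : LeftComod k C) (hM : finiteDual k C M) :
    ∃ (J : LeftComod k C) (j : M ⟶ J), finiteCofree k C J ∧ Mono j ∧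
      finiteDual k C (cokernel j) := by
  obtain ⟨J, j, hJ, hj⟩ := exists_range_map_eq (M := M) (Module.Finite.fg_top (self := hM))
  refine ⟨J, j, hJ, ?_, ?_⟩
  · have : Epi ((dualFunctor k C).map j.op) := (ModuleCat.epi_iff_range_eq_top _).2 hj
    have := (dualFunctor k C).epi_of_epi_map this
    exact unop_mono_of_epi j.op
  · have : Module.Finite (Coalgebra.DualAlgebra k C) ((dualFunctor k C).obj (op J)) := hJ.2
    exact Module.Finite.of_injective ((dualFunctor k C).map (cokernel.π j).op).hom
      ((ModuleCat.mono_iff_injective _).1 inferInstance)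

/-- In a presentation of the module by duals of cofree comodules the relations are a transpose, so
the module is the dual of its kernel. -/
lemma exists_dualFunctor_obj_iso (V : ModuleCat.{u} (Coalgebra.DualAlgebra k C))
    [Module.Finite (Coalgebra.DualAlgebra k C) V] :
    ∃ M, Nonempty ((dualFunctor k C).obj (op M) ≅ V) := by
  obtain ⟨X, p, hX, _⟩ := exists_epi V
  have : Module.Finite (Coalgebra.DualAlgebra k C) ((dualFunctor k C).obj (op X)) := hX.2
  have : Module.Finite (Coalgebra.DualAlgebra k C) (kernel p : ModuleCat.{u} _) :=
    Module.Finite.of_injective (kernel.ι p).hom ((ModuleCat.mono_iff_injective _).1 inferInstance)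
  obtain ⟨Y, q, hY, _⟩ := exists_epi (kernel p)
  obtain ⟨f, hf⟩ := hY.1.2 X (q ≫ kernel.ι p)
  exact ⟨kernel f, ⟨(dualFunctor k C).mapIso (cokernelOpOp f).symm ≪≫
    PreservesCokernel.iso (dualFunctor k C) f.op ≪≫ cokernelIsoOfEq hf ≪≫
    cokernelEpiComp q (kernel.ι p) ≪≫
    (colimit.isColimit _).coconePointUniqueUpToIso
      (Abelian.epiIsCokernelOfKernel _ (kernelIsKernel p))⟩⟩

variable (k C) in
lemma isDerivedDuality_dualFunctor : IsDerivedDuality (dualFunctor k C)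
    (finiteDimensional k C) (ModuleCat.finiteDimensional k (Coalgebra.DualAlgebra k C)) where
  resolution M hM := by
    obtain ⟨R, hR⟩ := exists_injectiveResolution_of_embeddings (finiteDual k C) (finiteCofree k C)
      (fun _ hX => hX.1.injective) exists_embedding M (finiteDual_of_finiteDimensional hM)
    exact ⟨R, fun n => (hR n).1⟩
  prop_iff := finiteDimensional_iff
  essSurj V hV :=
    have := finite_of_finiteDimensional hV
    exists_dualFunctor_obj_iso V

end noetherian

end LeftComod

theorem mainTheorem7_general (k : Type u) [Field k] (C : Type u) [AddCommGroup C] [Module k C]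
    [Coalgebra k C] (hC : WellFoundedLT {V : Submodule k C //
      ∀ c ∈ V, Coalgebra.comul (R := k) c ∈ LinearMap.range (V.subtype.lTensor C)}) (n : ℤ) :
    Coalgebra.IsLeftCalabiYau k C n ↔
      Algebra.IsCalabiYau k (Coalgebra.DualAlgebra k C) n := by
  have := LeftComod.isNoetherianRing_dualAlgebra hC
  let _ := HasDerivedCategory.standard (LeftComod k C)
  let _ := HasDerivedCategory.standard (ModuleCat.{u} (Coalgebra.DualAlgebra k C))
  exact (LeftComod.isDerivedDuality_dualFunctor k C).isCalabiYauCategory_iff n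

theorem mainTheorem7 (k : Type u) [Field k] [IsAlgClosed k] [CharZero k]
    (C : Type u) [AddCommGroup C] [Module k C] [Coalgebra k C]
    (hC : Coalgebra.IsArtinian k C) (n : ℤ) :
    Coalgebra.IsLeftCalabiYau k C n ↔
      Algebra.IsCalabiYau k (Coalgebra.DualAlgebra k C) n :=
  mainTheorem7_general k C hC.left n
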